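/- **Conventions.** All rings are commutative. A module is *uniserial* if its submodules are totally ordered by inclusion; a *valuation domain* is an integral domain $R$ that is uniserial as an $R$-module. Let $R$ be a valuation domain with quotient field $Q$. A uniserial $R$-module is *standard* if it is isomorphic to $J/A$ for some $R$-submodules $A\subseteq J$ of $Q$, and *non-standard* otherwise. For $0\neq a\in U$, $U$ uniserial, let $\mathrm{Ann}(a)=\{r\in R: ra=0\}$ and $D(a)=\bigcup\{r^{-1}R : r \text{ divides } a \text{ in } U\}\subseteq Q$; $U$ is *of type* $J/A$ if $D(a)/\mathrm{Ann}(a)\cong J/A$ for some (equivalently, every) non-zero $a\in U$. For $S\subseteq\omega_1$ let $\tilde S$ denote the class of $S$ under the equivalence relation "$S\cap C=S'\cap C$ for some closed unbounded $C\subseteq\omega_1$". If $Q=\bigcup_{\nu<\omega_1}r_\nu^{-1}R$ with non-zero $r_\nu\in R$ and $r_\mu\mid r_\nu$ for $\mu<\nu$, then $\Gamma_R(Q/R)$ is the class of $$\Big\{\delta<\omega_1 : \delta\text{ a limit ordinal and } R\big/\textstyle\bigcap_{\nu<\delta}r_\nu R\text{ is not complete}\Big\},$$ completeness being in the linear topology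 with basis $\{r_\nu R:\nu<\delta\}$ of neighbourhoods of $0$. (The class does not depend on the choice of the sequence $(r_\nu)$.) **Theorem.** Assume CH. For every field $K$ of cardinality $\aleph_1$ and every stationary subset $S$ of $\omega_1$ there is a valuation domain $R$, not a field, of cardinality $\aleph_1$, with residue field isomorphic to $K$ and quotient field $Q$, such that $\Gamma_R(Q/R)$ is defined and equal to $\tilde S$, and such that there is a non-standard uniserial $R$-module of type $Q/R$. Moreover $R$ can be taken to be a subring of the Hahn series ring $K[[G]]$, where $G=\bigoplus_{\alpha<\omega_1}\mathbb Z\alpha$ is ordered anti-lexicographically (a non-zero element is positive iff its coefficient at its largest index is positive), such that all elements of $R$ have support in $G^+=\{g\in G: g\ge 0\}$ and $R$ contains all monomials $kX^g$ with $k\in K$, $g\in G^+$. -/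

import Mathlib

open scoped Cardinal Ordinal

universe u v w

namespace Uniserial

/-! ### Subsets of `ω₁` modulo closed unbounded sets -/

/-- The well-ordered set `ω₁` of countable ordinals. -/
abbrev Omega1 : Type := (ω₁ : Ordinal.{0}).ToType

/-- `S` and `T` have the same class in `D(ω₁)`: they agree on a closed unbounded set. -/
def ClubEquiv (S T : Set Omega1) : Prop :=
  ∃ C : Set Omega1, IsClub C ∧ S ∩ C = T ∩ C

/-! ### Uniserial modules -/

/-- The submodules of `U` are totally ordered by inclusion. -/
def IsUniserial (R : Type u) [CommRing R] (U : Type v) [AddCommGroup U] [Module R U] : Prop :=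
  ∀ M N : Submodule R U, M ≤ N ∨ N ≤ M

section Types

variable {R : Type u} [CommRing R] {Q : Type w} [Field Q] [Algebra R Q]

/-- The quotient `J/A` of two `R`-submodules `A ⊆ J` of `Q`. -/
abbrev TypeQuotient (J A : Submodule R Q) : Type w := J ⧸ A.submoduleOf J

/-- The cyclic submodule `r⁻¹R` of `Q`. -/
noncomputable def invSpan (Q : Type w) [Field Q] [Algebra R Q] (r : R) : Submodule R Q :=
  Submodule.span R {(algebraMap R Q r)⁻¹}

/-- `Ann(a)`, as a submodule of `Q`. -/
noncomputable def annIn (Q : Type w) [Field Q] [Algebra R Q] {U : Type v} [AddCommGroup U]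
    [Module R U] (a : U) : Submodule R Q :=
  Submodule.map (Algebra.linearMap R Q) (Ideal.torsionOf R U a)

/-- `D(a)`, the union of all `r⁻¹R` such that `r` divides `a` in `U`. (Over a valuation domain the
submodules `r⁻¹R` form a chain, so that their supremum is their union.) -/
noncomputable def divIn (Q : Type w) [Field Q] [Algebra R Q] {U : Type v} [AddCommGroup U]
    [Module R U] (a : U) : Submodule R Q :=
  ⨆ r : {r : R // ∃ b : U, r • b = a}, invSpan Q r.1

/-- The uniserial module `U` is of type `J/A`: `J/A ≅ D(a)/Ann(a)` for a nonzero `a` in `U`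
(for uniserial `U`, the isomorphism class of `D(a)/Ann(a)` does not depend on `a`). -/
def IsOfType (U : Type v) [AddCommGroup U] [Module R U] (J A : Submodule R Q) : Prop :=
  ∃ a : U, a ≠ 0 ∧ Nonempty (TypeQuotient J A ≃ₗ[R] TypeQuotient (divIn (R := R) Q a) (annIn (R := R) Q a))

/-- `U` is standard: it is isomorphic to `J/A` for some submodules `A ⊆ J` of `Q`. -/
def IsStandard (R : Type u) [CommRing R] (Q : Type w) [Field Q] [Algebra R Q]
    (U : Type v) [AddCommGroup U] [Module R U] : Prop :=
  ∃ J A : Submodule R Q, A ≤ J ∧ Nonempty (U ≃ₗ[R] TypeQuotient J A)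

/-! ### The invariant `Γ_R(J/A)` -/

/-- `J` is the union of the chain `r_ν⁻¹R` (`ν < ω₁`), where `r_μ ∣ r_ν` for `μ < ν`. -/
def IsGeneratingSeq (J : Submodule R Q) (r : Omega1 → R) : Prop :=
  (∀ ν, r ν ≠ 0) ∧ (∀ μ ν, μ < ν → r μ ∣ r ν) ∧ ∀ x : Q, x ∈ J ↔ ∃ ν, x ∈ invSpan Q (r ν)

/-- `J_δ`, the union of the chain of submodules `r_ν⁻¹R` with `ν < δ`. -/
noncomputable def initialPart (Q : Type w) [Field Q] [Algebra R Q] (r : Omega1 → R) (δ : Omega1) :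
    Submodule R Q :=
  ⨆ ν : Set.Iio δ, invSpan Q (r ν)

/-- The ideal `(A : J_δ)` of `R`. -/
noncomputable def colonIdeal (A : Submodule R Q) (r : Omega1 → R) (δ : Omega1) : Ideal R :=
  A.colon (initialPart Q r δ : Set Q)

/-- The ideal `r_ν A` of `R` (for `A ⊆ R ⊆ Q`). -/
noncomputable def scaledIdeal (A : Submodule R Q) (r : Omega1 → R) (ν : Omega1) : Ideal R :=
  (A.map (LinearMap.lsmul R Q (r ν))).comap (Algebra.linearMap R Q)

/-- The neighbourhood of `0` in `R/(A : J_δ)` given by `r_ν A`. -/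
noncomputable def basicNhd (A : Submodule R Q) (r : Omega1 → R) (δ ν : Omega1) :
    Ideal (R ⧸ colonIdeal A r δ) :=
  (scaledIdeal A r ν).map (Ideal.Quotient.mk (colonIdeal A r δ))

/-- `R/(A : J_δ)` is complete in the metrizable linear topology for which the `r_ν A` (`ν < δ`)
form a basis of neighbourhoods of `0`: every Cauchy sequence converges. -/
def IsCompleteAt (A : Submodule R Q) (r : Omega1 → R) (δ : Omega1) : Prop :=
  ∀ x : ℕ → R ⧸ colonIdeal A r δ,
    (∀ ν < δ, ∃ n₀, ∀ m ≥ n₀, ∀ n ≥ n₀, x m - x n ∈ basicNhd A r δ ν) →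
    ∃ y, ∀ ν < δ, ∃ n₀, ∀ n ≥ n₀, x n - y ∈ basicNhd A r δ ν

/-- The set of limit ordinals `δ < ω₁` such that `R/(A : J_δ)` is not complete. -/
def incompleteSet (A : Submodule R Q) (r : Omega1 → R) : Set Omega1 :=
  {δ | Order.IsSuccLimit δ ∧ ¬ IsCompleteAt A r δ}

/-- `Γ_R(J/A)` is defined and equal to the class of `S`: there are sequences `(r_ν)` generating
`J`, and each of them gives a set with the same class as `S`. -/
def GammaEq (J A : Submodule R Q) (S : Set Omega1) : Prop :=
  (∃ r : Omega1 → R, IsGeneratingSeq J r) ∧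
    ∀ r : Omega1 → R, IsGeneratingSeq J r → ClubEquiv (incompleteSet A r) S

end Types

/-! ### The value group and the Hahn series ring -/

/-- The group `⊕_{α < ω₁} ℤα`, ordered anti-lexicographically: an element is positive if its
coefficient at the largest index of its support is positive. -/
abbrev ValueGroup : Type := Colex (Omega1 →₀ ℤ)

/-- The ring `K[[G⁺]]` of formal series over `K` with well-ordered support contained in
`G⁺ = {g ∈ G : g ≥ 0}`, where `G = ⊕_{α < ω₁} ℤα`. -/
def nonnegSeries (K : Type u) [Field K] : Set (HahnSeries ValueGroup K) :=
  {f | ∀ g ∈ f.support, 0 ≤ g}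

end Uniserial

/-! The ring is cut out of `K[[G⁺]]` by support conditions placed at the limit ordinals of `S`. Let
`F` be the set of Hahn series whose support lies in some `below ν` and, for every limit `δ ∈ S`,
meets each coset of the convex subgroup `below δ` in elements whose coordinates below `δ` vanish
from some `ν < δ` on. `F` is a field (`FiberwiseIn.mul`, `FiberwiseIn.inv`), so `R`, its part with
nonnegative support, is a valuation domain. Under CH it has only `ℵ₁` elements, because each series
lives on a countable set of exponents.

For `Γ`, take `r_ν = X^ν`. If `δ ∈ S` is a limit, a sum of monomials `X^α` over a set of `α` cofinal
in `δ` is Cauchy, but a limit would violate the condition at `δ`. If `δ ∉ S`, coefficientwise limits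
exist and satisfy every condition: those at `δ' > δ` trivially, those at `δ' < δ` because each
relevant coset only sees one term of the sequence. Two generating sequences are interleaved at a
club of `δ`, so the class does not depend on the choice.

For the module, let `coh β : β → ℕ` be finite-to-one functions that cohere modulo finite sets
(`finite_coh_le`, `finite_coh_ne`), and put `f_ν = ∏_{α<ν} (1 + X^{(coh ν α + 1)α})`. Finitely many
binomials are units of `R`, so `f_μ` is congruent to a unit multiple of `f_ν` modulo `X^μ`
(`exists_unit_cohSeries`). Hence the classes of `f_ν / X^ν` modulo `K[[G⁺]]` generate an increasing
chain of cyclic modules `R/X^νR`, whose union is uniserial of type `Q/R`. If it were standard, there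
would be units `w_ν` of `R` with `f_μ w_ν ≡ f_ν w_μ` modulo `X^μ`
(`IsCyclicChain.exists_units_of_isStandard`). For a limit `δ ∈ S`, the support of `w_δ` inside
`below δ` is bounded by some `ν < δ`; pressing down on the stationary set `S` yields one `ν` for
unboundedly many `δ`. Comparing coefficients then shows that the corresponding `coh δ` agree exactly
from `ν` on (`coh_eq_of_units`), so they glue to a finite-to-one function into `ℕ` on an uncountable
set, which is absurd (`not_coherent`). -/

set_option linter.unusedSectionVars false

namespace Uniserial

/-! ### Restricting the support of a Hahn series -/

section Restrict

variable {Γ : Type*} [LinearOrder Γ] {K : Type*} [Field K]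

open scoped Classical in
/-- The part of a Hahn series supported in `s`. -/
noncomputable def restrict (s : Set Γ) (f : HahnSeries Γ K) : HahnSeries Γ K where
  coeff x := if x ∈ s then f.coeff x else 0
  isPWO_support' := f.isPWO_support.mono fun x hx => by
    simp only [Function.mem_support, ne_eq, ite_eq_right_iff, not_forall] at hx
    exact hx.2

open scoped Classical in
theorem coeff_restrict (s : Set Γ) (f : HahnSeries Γ K) (x : Γ) :
    (restrict s f).coeff x = if x ∈ s then f.coeff x else 0 := rfl

theorem mem_support_restrict {s : Set Γ} {f : HahnSeries Γ K} {x : Γ} :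
    x ∈ (restrict s f).support ↔ x ∈ s ∧ x ∈ f.support := by
  simp [coeff_restrict]

theorem restrict_add (s : Set Γ) (f g : HahnSeries Γ K) :
    restrict s (f + g) = restrict s f + restrict s g := by
  ext x
  by_cases hx : x ∈ s <;> simp [coeff_restrict, hx]

theorem restrict_eq_self {s : Set Γ} {f : HahnSeries Γ K} (h : f.support ⊆ s) :
    restrict s f = f := by
  ext x
  by_cases hx : x ∈ s
  · simp [coeff_restrict, hx]
  · have : f.coeff x = 0 := by
      by_contra h0
      exact hx (h h0)
    simp [coeff_restrict, hx, this]

theorem restrict_eq_zero {s : Set Γ} {f : HahnSeries Γ K} (h : ∀ x ∈ f.support, x ∉ s) :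
    restrict s f = 0 := by
  ext x
  by_cases hx : x ∈ s
  · have : f.coeff x = 0 := by
      by_contra h0
      exact h x h0 hx
    simp [coeff_restrict, hx, this]
  · simp [coeff_restrict, hx]

theorem restrict_add_restrict_compl (s : Set Γ) (f : HahnSeries Γ K) :
    restrict s f + restrict sᶜ f = f := by
  ext x
  by_cases hx : x ∈ s <;> simp [coeff_restrict, hx]

end Restrict

/-! ### Fields of Hahn series defined by conditions on the fibres of a homomorphism -/

section Subfields

variable {Γ Γ' : Type*} [AddCommGroup Γ] [LinearOrder Γ] [IsOrderedAddMonoid Γ]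
  [AddCommGroup Γ'] [LinearOrder Γ'] [IsOrderedAddMonoid Γ'] {K : Type*} [Field K]

theorem exists_add_of_mem_support_mul {f g : HahnSeries Γ K} {x : Γ} (hx : x ∈ (f * g).support) :
    ∃ p ∈ f.support, ∃ q ∈ g.support, p + q = x :=
  Set.mem_add.1 (HahnSeries.support_mul_subset hx)

theorem mem_or_mem_support_add {f g : HahnSeries Γ K} {x : Γ} (hx : x ∈ (f + g).support) :
    x ∈ f.support ∨ x ∈ g.support := by
  by_contra! h
  simp only [HahnSeries.mem_support, not_not] at h
  simp [h.1, h.2] at hx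

/-- Split `f⁻¹` into its parts on and off `N`. Multiplication by `f` preserves this splitting, and
`1` is supported in `N`, so the part on `N` is already an inverse of `f`. -/
theorem support_inv_subset (N : AddSubgroup Γ) {f : HahnSeries Γ K} (h : f.support ⊆ N) :
    f⁻¹.support ⊆ N := by
  rcases eq_or_ne f 0 with rfl | hf
  · simp
  have h1 : restrict N (f * restrict N f⁻¹) + restrict N (f * restrict (N : Set Γ)ᶜ f⁻¹) = 1 := by
    rw [← restrict_add, ← mul_add, restrict_add_restrict_compl, mul_inv_cancel₀ hf]
    refine restrict_eq_self ?_
    rw [HahnSeries.support_one]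
    simp
  rw [restrict_eq_self (f := f * _), restrict_eq_zero (f := f * _), add_zero] at h1
  · rw [← eq_inv_of_mul_eq_one_right h1]
    exact fun x hx => (mem_support_restrict.1 hx).1
  · intro x hx
    obtain ⟨p, hp, q, hq, rfl⟩ := exists_add_of_mem_support_mul hx
    have hq' := (mem_support_restrict.1 hq).1
    exact fun hpq => hq' ((N.add_mem_cancel_left (h hp)).1 hpq)
  · intro x hx
    obtain ⟨p, hp, q, hq, rfl⟩ := exists_add_of_mem_support_mul hx
    exact N.add_mem (h hp) (mem_support_restrict.1 hq).1

variable {ι : Type*} [Nonempty ι] (π : Γ →+ Γ') (N : ι → AddSubgroup Γ)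

/-- Every fibre of `π` meets the support of `f` in a subset of some `N i`. -/
def FiberwiseIn (f : HahnSeries Γ K) : Prop :=
  ∀ c, ∃ i, ∀ x ∈ f.support, π x = c → x ∈ N i

variable {π N}

theorem FiberwiseIn.mono {f g : HahnSeries Γ K} (hf : FiberwiseIn π N f)
    (h : g.support ⊆ f.support) : FiberwiseIn π N g := fun c =>
  let ⟨i, hi⟩ := hf c
  ⟨i, fun x hx => hi x (h hx)⟩

theorem FiberwiseIn.add (hN : Directed (· ≤ ·) N) {f g : HahnSeries Γ K} (hf : FiberwiseIn π N f)
    (hg : FiberwiseIn π N g) : FiberwiseIn π N (f + g) := by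
  intro c
  obtain ⟨i, hi⟩ := hf c
  obtain ⟨j, hj⟩ := hg c
  obtain ⟨k, hik, hjk⟩ := hN i j
  refine ⟨k, fun x hx hc => ?_⟩
  rcases mem_or_mem_support_add hx with h | h
  exacts [hik (hi x h hc), hjk (hj x h hc)]

theorem FiberwiseIn.neg {f : HahnSeries Γ K} (hf : FiberwiseIn π N f) : FiberwiseIn π N (-f) :=
  hf.mono (by rw [HahnSeries.support_neg])

-- The images of both supports are partially well-ordered, so only finitely many pairs of fibres
-- contribute to a given fibre of the product; directedness then provides one `N k` for all of them.
open scoped Classical in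
theorem FiberwiseIn.mul (hπ : Monotone π) (hN : Directed (· ≤ ·) N) {f g : HahnSeries Γ K}
    (hf : FiberwiseIn π N f) (hg : FiberwiseIn π N g) : FiberwiseIn π N (f * g) := by
  intro c
  have hs : (π '' f.support).IsPWO := f.isPWO_support.image_of_monotone hπ
  have ht : (π '' g.support).IsPWO := g.isPWO_support.image_of_monotone hπ
  choose i hi using hf
  choose j hj using hg
  have h2 : ∀ p : Γ' × Γ', ∃ k, N (i p.1) ≤ N k ∧ N (j p.2) ≤ N k := fun p => hN _ _
  choose m hm using h2
  obtain ⟨k, hk⟩ := hN.finset_le ((Finset.antidiagonal hs ht c).image m)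
  refine ⟨k, fun x hx hc => ?_⟩
  obtain ⟨p, hp, q, hq, rfl⟩ := exists_add_of_mem_support_mul hx
  have hmem : (π p, π q) ∈ Finset.antidiagonal hs ht c := by
    rw [Finset.mem_antidiagonal]
    exact ⟨⟨p, hp, rfl⟩, ⟨q, hq, rfl⟩, by rw [← hc, map_add]⟩
  have := hk _ (Finset.mem_image_of_mem m hmem)
  exact (N k).add_mem (this ((hm _).1 (hi _ p hp rfl))) (this ((hm _).2 (hj _ q hq rfl)))

theorem fiberwiseIn_single {i : ι} {g : Γ} (hg : g ∈ N i) (a : K) :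
    FiberwiseIn π N (HahnSeries.single g a) := fun _ =>
  ⟨i, fun x hx _ => by rwa [HahnSeries.eq_of_mem_support_single hx]⟩

/-- Look at the least fibre `c` on which `f⁻¹` is bad. The equation `f * f⁻¹ = 1`, read on the fibre
`c₀ + c` with `c₀` the lowest fibre of `f`, expresses that part of `f⁻¹` through its earlier, good
fibres. -/
theorem FiberwiseIn.inv (hπ : Monotone π) (hN : Directed (· ≤ ·) N) {f : HahnSeries Γ K}
    (hf : FiberwiseIn π N f) : FiberwiseIn π N f⁻¹ := by
  rcases eq_or_ne f 0 with rfl | hf0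
  · simpa using hf
  by_contra hbad
  have hy : (π '' f⁻¹.support).IsWF := (f⁻¹.isPWO_support.image_of_monotone hπ).isWF
  set B : Set Γ' := {c | ¬ ∃ i, ∀ x ∈ f⁻¹.support, π x = c → x ∈ N i} with hB
  have hBs : B ⊆ π '' f⁻¹.support := by
    intro c hc
    by_contra hcs
    obtain ⟨i⟩ := ‹Nonempty ι›
    exact hc ⟨i, fun x hx hxc => (hcs ⟨x, hx, hxc⟩).elim⟩
  have hBne : B.Nonempty := by
    simp only [FiberwiseIn, not_forall] at hbad
    exact hbad
  have hBwf : B.IsWF := hy.mono hBs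
  set c := hBwf.min hBne with hc
  have hcB : c ∈ B := hBwf.min_mem hBne
  have hlt : ∀ d < c, d ∉ B := fun d hd hdB => hBwf.not_lt_min hBne hdB hd
  set c₀ := π f.order
  set a := restrict {x | π x = c₀} f
  set f' := restrict {x | π x = c₀}ᶜ f
  set y₁ := restrict {x | π x < c} f⁻¹
  set y' := restrict {x | π x < c}ᶜ f⁻¹
  set y₂ := restrict {x | π x = c} y'
  set y₃ := restrict {x | π x = c}ᶜ y'
  have hfa : a + f' = f := restrict_add_restrict_compl _ _
  have hy23 : y₂ + y₃ = y' := restrict_add_restrict_compl _ _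
  have hyy : y₁ + y' = f⁻¹ := restrict_add_restrict_compl _ _
  have hsf : ∀ x ∈ f.support, c₀ ≤ π x := fun x hx =>
    hπ (HahnSeries.order_le_of_coeff_ne_zero hx)
  have hf'lt : ∀ x ∈ f'.support, c₀ < π x := fun x hx =>
    lt_of_le_of_ne (hsf x (mem_support_restrict.1 hx).2)
      (Ne.symm (mem_support_restrict.1 hx).1)
  have hy'le : ∀ x ∈ y'.support, c ≤ π x := fun x hx => not_lt.1 (mem_support_restrict.1 hx).1
  have hy3lt : ∀ x ∈ y₃.support, c < π x := fun x hx =>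
    lt_of_le_of_ne (hy'le x (mem_support_restrict.1 hx).2)
      (Ne.symm (mem_support_restrict.1 hx).1)
  -- Of the products of the pieces of `f` and `f⁻¹`, only `a * y₂` and `f' * y₁` can reach the fibre
  -- `c₀ + c`.
  have hay : a * y₂ = restrict {x | π x = c₀ + c} (1 + -(f' * y₁)) := by
    have h1 : 1 + -(f' * y₁) = a * y₂ + (a * y₁ + (a * y₃ + f' * y')) := by
      rw [← mul_inv_cancel₀ hf0, ← hyy]
      nth_rewrite 1 [← hfa]
      rw [← hy23]
      ring
    rw [h1, restrict_add, restrict_add, restrict_add, restrict_eq_self, restrict_eq_zero,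
      restrict_eq_zero, restrict_eq_zero]
    · simp
    · intro x hx
      obtain ⟨p, hp, q, hq, rfl⟩ := exists_add_of_mem_support_mul hx
      simp only [Set.mem_ofPred_eq, map_add]
      exact (add_lt_add_of_lt_of_le (hf'lt p hp) (hy'le q hq)).ne'
    · intro x hx
      obtain ⟨p, hp, q, hq, rfl⟩ := exists_add_of_mem_support_mul hx
      simp only [Set.mem_ofPred_eq, map_add]
      have h := (mem_support_restrict.1 hp).1
      simp only [Set.mem_ofPred_eq] at h
      rw [h]
      exact (add_lt_add_right (hy3lt q hq) c₀).ne'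
    · intro x hx
      obtain ⟨p, hp, q, hq, rfl⟩ := exists_add_of_mem_support_mul hx
      simp only [Set.mem_ofPred_eq, map_add]
      have h := (mem_support_restrict.1 hp).1
      simp only [Set.mem_ofPred_eq] at h
      rw [h]
      exact (add_lt_add_right (mem_support_restrict.1 hq).1 c₀).ne
    · intro x hx
      obtain ⟨p, hp, q, hq, rfl⟩ := exists_add_of_mem_support_mul hx
      simp only [Set.mem_ofPred_eq, map_add]
      rw [(mem_support_restrict.1 hp).1, (mem_support_restrict.1 hq).1]
  have hf' : FiberwiseIn π N f' := hf.mono fun x hx => (mem_support_restrict.1 hx).2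
  have hy1 : FiberwiseIn π N y₁ := by
    intro d
    by_cases hd : d < c
    · obtain ⟨i, hi⟩ := not_not.1 (hlt d hd)
      exact ⟨i, fun x hx => hi x (mem_support_restrict.1 hx).2⟩
    · obtain ⟨i⟩ := ‹Nonempty ι›
      exact ⟨i, fun x hx hxd => (hd (hxd ▸ (mem_support_restrict.1 hx).1)).elim⟩
  have hone : FiberwiseIn π N (1 : HahnSeries Γ K) :=
    fiberwiseIn_single (i := Classical.arbitrary ι) (zero_mem _) 1
  obtain ⟨i, hi⟩ := (hone.add hN (hf'.mul hπ hN hy1).neg) (c₀ + c)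
  obtain ⟨j, hj⟩ := hf c₀
  obtain ⟨k, hik, hjk⟩ := hN i j
  have ha : a.support ⊆ N k := fun x hx =>
    hjk (hj x (mem_support_restrict.1 hx).2 (mem_support_restrict.1 hx).1)
  have ha0 : a ≠ 0 := by
    apply HahnSeries.ne_zero_of_coeff_ne_zero (g := f.order)
    rw [← HahnSeries.mem_support, mem_support_restrict]
    exact ⟨rfl, HahnSeries.coeff_order_eq_zero.not.2 hf0⟩
  -- Dividing by `a` does not leave `N k`, since `a` lies on a single fibre with support in the
  -- subgroup `N k`.
  have hy2 : y₂.support ⊆ N k := by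
    have : y₂ = a⁻¹ * restrict {x | π x = c₀ + c} (1 + -(f' * y₁)) := by
      rw [← hay, inv_mul_cancel_left₀ ha0]
    rw [this]
    intro x hx
    obtain ⟨p, hp, q, hq, rfl⟩ := exists_add_of_mem_support_mul hx
    refine (N k).add_mem (support_inv_subset _ ha hp) ?_
    exact hik (hi q (mem_support_restrict.1 hq).2 (mem_support_restrict.1 hq).1)
  refine hcB ⟨k, fun x hx hxc => hy2 ?_⟩
  rw [mem_support_restrict, mem_support_restrict]
  exact ⟨hxc, by simp [hxc], hx⟩

/-- The field of Hahn series whose support meets every fibre of `π` in a subset of some `N i`. -/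
def fiberSubfield (hπ : Monotone π) (hN : Directed (· ≤ ·) N) : Subfield (HahnSeries Γ K) where
  carrier := {f | FiberwiseIn π N f}
  mul_mem' hf hg := hf.mul hπ hN hg
  one_mem' := fiberwiseIn_single (i := Classical.arbitrary ι) (zero_mem _) 1
  add_mem' hf hg := hf.add hN hg
  zero_mem' := fun _ => ⟨Classical.arbitrary ι, by simp⟩
  neg_mem' hf := hf.neg
  inv_mem' _ hf := hf.inv hπ hN

end Subfields

/-! ### The ordinal `ω₁` -/

section Omega1

instance : NoMaxOrder Omega1 := by
  rw [← Ordinal.isSuccPrelimit_type_lt_iff, Ordinal.type_toType]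
  exact (Cardinal.isSuccLimit_omega 1).isSuccPrelimit

instance : Nonempty Omega1 := by
  rw [Ordinal.nonempty_toType_iff]
  exact (Ordinal.omega_pos 1).ne'

theorem mk_omega1 : Cardinal.mk Omega1 = (ℵ₁ : Cardinal.{0}) := by
  simp [Omega1]

theorem countable_Iio (δ : Omega1) : (Set.Iio δ).Countable := by
  rw [← Cardinal.le_aleph0_iff_set_countable, ← Cardinal.lt_aleph_one_iff, ← mk_omega1]
  exact Cardinal.mk_Iio_lt δ (by rw [mk_omega1, Ordinal.type_toType, Cardinal.ord_aleph])

theorem countable_Iic (δ : Omega1) : (Set.Iic δ).Countable := by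
  obtain ⟨μ, hμ⟩ := exists_gt δ
  exact (countable_Iio μ).mono fun x hx => lt_of_le_of_lt hx hμ

theorem bddAbove_of_countable {s : Set Omega1} (hs : s.Countable) : BddAbove s := by
  by_contra h
  have h1 : (⋃ x ∈ s, Set.Iic x) = Set.univ := by
    refine Set.eq_univ_of_forall fun y => ?_
    obtain ⟨x, hx, hy⟩ := not_bddAbove_iff.1 h y
    exact Set.mem_biUnion hx hy.le
  have h2 : (Set.univ : Set Omega1).Countable := h1 ▸ hs.biUnion fun x _ => countable_Iic x
  rw [← Cardinal.le_aleph0_iff_set_countable, ← Cardinal.lt_aleph_one_iff, Cardinal.mk_univ,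
    mk_omega1] at h2
  exact lt_irrefl _ h2

theorem exists_isLUB {s : Set Omega1} (hs : BddAbove s) : ∃ x, IsLUB s x := by
  refine ⟨WellFounded.min wellFounded_lt (upperBounds s) hs, WellFounded.min_mem _ _ _, ?_⟩
  intro y hy
  exact not_lt.1 (WellFounded.not_lt_min wellFounded_lt (s := upperBounds s) hy)

theorem isSuccLimit_of_forall {δ μ : Omega1} (hμ : μ < δ) (h : ∀ ν < δ, ∃ ξ, ν < ξ ∧ ξ < δ) :
    Order.IsSuccLimit δ := by
  refine ⟨fun hm => (hm.not_lt hμ), fun ν hν => ?_⟩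
  obtain ⟨ξ, h1, h2⟩ := h ν hν.lt
  exact hν.2 h1 h2

theorem exists_between_of_isSuccLimit {δ ν : Omega1} (hδ : Order.IsSuccLimit δ) (hν : ν < δ) :
    ∃ ξ, ν < ξ ∧ ξ < δ :=
  ⟨Order.succ ν, Order.lt_succ ν, hδ.succ_lt hν⟩

/-- The limit ordinals closed under `φ`. -/
def closurePoints (φ : Omega1 → Omega1) : Set Omega1 :=
  {δ | Order.IsSuccLimit δ ∧ ∀ ν < δ, φ ν < δ}

theorem isClub_closurePoints (φ : Omega1 → Omega1) : IsClub (closurePoints φ) := by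
  refine ⟨?_, ?_⟩
  · intro t ht hne _ x hx
    have key : ∀ ν < x, ∃ y ∈ t, ν < y := fun ν hν => (lt_isLUB_iff hx).1 hν
    obtain ⟨y₀, hy₀⟩ := hne
    obtain ⟨μ, hμ⟩ := not_isMin_iff.1 (ht hy₀).1.not_isMin
    refine ⟨isSuccLimit_of_forall (hμ.trans_le (hx.1 hy₀)) fun ν hν => ?_, fun ν hν => ?_⟩
    · obtain ⟨y, hy, hνy⟩ := key ν hν
      obtain ⟨ξ, h1, h2⟩ := exists_between_of_isSuccLimit (ht hy).1 hνy
      exact ⟨ξ, h1, h2.trans_le (hx.1 hy)⟩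
    · obtain ⟨y, hy, hνy⟩ := key ν hν
      exact ((ht hy).2 ν hνy).trans_le (hx.1 hy)
  · intro a
    have hg : ∀ b : Omega1, ∃ c, b < c ∧ ∀ ν ≤ b, φ ν < c := by
      intro b
      obtain ⟨c, hc⟩ := bddAbove_of_countable ((countable_Iic b).image φ)
      obtain ⟨d, hd⟩ := exists_gt (max b c)
      refine ⟨d, (le_max_left _ _).trans_lt hd, fun ν hν => ?_⟩
      exact ((hc ⟨ν, hν, rfl⟩).trans (le_max_right _ _)).trans_lt hd
    choose g hg1 hg2 using hg
    -- The supremum of the iterates of `g` is closed under `φ`, as `g` passes all values of `φ` on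
    -- the ordinals up to its argument.
    set x : ℕ → Omega1 := fun n => g^[n] a
    have hx : ∀ n, x (n + 1) = g (x n) := fun n => Function.iterate_succ_apply' g n a
    obtain ⟨δ, hδ⟩ := exists_isLUB (bddAbove_of_countable (Set.countable_range x))
    have hlt : ∀ n, x n < δ := fun n =>
      (hg1 (x n)).trans_le (by rw [← hx]; exact hδ.1 ⟨n + 1, rfl⟩)
    have key : ∀ ν < δ, ∃ n, ν < x n := fun ν hν => by
      obtain ⟨_, ⟨n, rfl⟩, hn⟩ := (lt_isLUB_iff hδ).1 hν
      exact ⟨n, hn⟩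
    refine ⟨δ, ⟨isSuccLimit_of_forall (hlt 0) fun ν hν => ?_, fun ν hν => ?_⟩, (hlt 0).le⟩
    · obtain ⟨n, hn⟩ := key ν hν
      exact ⟨x n, hn, hlt n⟩
    · obtain ⟨n, hn⟩ := key ν hν
      have := hg2 (x n) ν hn.le
      rw [← hx] at this
      exact this.trans (hlt _)

/-- A regressive function on a stationary set is bounded on an unbounded set
of limit ordinals. -/
theorem exists_unbounded_of_regressive {S : Set Omega1} (hS : IsStationary S)
    (h : Omega1 → Omega1) (hh : ∀ δ ∈ S, Order.IsSuccLimit δ → h δ < δ) :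
    ∃ ν, ∀ μ, ∃ δ ∈ S, Order.IsSuccLimit δ ∧ μ < δ ∧ h δ ≤ ν := by
  by_contra! hc
  choose b hb using hc
  -- Here `b ν` is a bound beyond which `h` exceeds `ν` on the limits in `S`. At a point `δ ∈ S`
  -- closed under `b`, taking `ν = h δ` gives `h δ < h δ`.
  obtain ⟨δ, hδS, hδ, hδb⟩ := hS (isClub_closurePoints b)
  exact (hb (h δ) δ hδS hδ (hδb _ (hh δ hδS hδ))).false

/-- A cofinal sequence in a countable limit ordinal. -/
theorem exists_cofinal_seq {δ : Omega1} (hδ : Order.IsSuccLimit δ) :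
    ∃ x : ℕ → Omega1, Monotone x ∧ (∀ n, x n < δ) ∧ ∀ ν < δ, ∃ n, ν < x n := by
  have : Countable (Set.Iio δ) := (countable_Iio δ).to_subtype
  obtain ⟨μ, hμ⟩ := not_isMin_iff.1 hδ.not_isMin
  have : Nonempty (Set.Iio δ) := ⟨⟨μ, hμ⟩⟩
  obtain ⟨x, hx, hx'⟩ := Filter.exists_seq_monotone_tendsto_atTop_atTop (Set.Iio δ)
  refine ⟨fun n => x n, fun m n h => hx h, fun n => (x n).2, fun ν hν => ?_⟩
  obtain ⟨ξ, h1, h2⟩ := exists_between_of_isSuccLimit hδ hν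
  obtain ⟨n, hn⟩ := (hx'.eventually_ge_atTop ⟨ξ, h2⟩).exists
  exact ⟨n, h1.trans_le hn⟩

end Omega1

/-! ### The value group -/

section ValueGroup

/-- The element of the value group with the single coefficient `n` at `α`. -/
noncomputable def vec (α : Omega1) (n : ℤ) : ValueGroup := toColex (Finsupp.single α n)

theorem vec_apply_self (α : Omega1) (n : ℤ) : ofColex (vec α n) α = n := by simp [vec]

theorem vec_apply_of_ne {α β : Omega1} (h : β ≠ α) (n : ℤ) : ofColex (vec α n) β = 0 := by
  simp [vec, h.symm]

theorem ext_coeff {g h : ValueGroup} (H : ∀ α, ofColex g α = ofColex h α) : g = h :=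
  Finsupp.ext (f := ofColex g) (g := ofColex h) H

theorem coeff_add (g h : ValueGroup) (α : Omega1) :
    ofColex (g + h) α = ofColex g α + ofColex h α := rfl

theorem coeff_sub (g h : ValueGroup) (α : Omega1) :
    ofColex (g - h) α = ofColex g α - ofColex h α := rfl

theorem coeff_neg (g : ValueGroup) (α : Omega1) : ofColex (-g) α = - ofColex g α := rfl

theorem coeff_zero (α : Omega1) : ofColex (0 : ValueGroup) α = 0 := rfl

theorem lt_iff_coeff {g h : ValueGroup} : g < h ↔
    ∃ i, (∀ j, i < j → ofColex g j = ofColex h j) ∧ ofColex g i < ofColex h i :=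
  Finsupp.Colex.lt_iff

theorem nonneg_of_coeff_nonneg {g : ValueGroup} (h : ∀ α, 0 ≤ ofColex g α) : 0 ≤ g :=
  Finsupp.toColex_monotone (a := 0) (b := ofColex g) h

/-- The convex subgroup of elements supported on ordinals less than `ν`. -/
def below (ν : Omega1) : AddSubgroup ValueGroup where
  carrier := {g | ∀ α, ν ≤ α → ofColex g α = 0}
  add_mem' hg hh α hα := by rw [coeff_add, hg α hα, hh α hα, add_zero]
  zero_mem' _ _ := rfl
  neg_mem' hg α hα := by rw [coeff_neg, hg α hα, neg_zero]

theorem below_mono : Monotone below := fun _ _ h _ hg α hα => hg α (h.trans hα)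

theorem vec_mem_below {α ν : Omega1} (h : α < ν) (n : ℤ) : vec α n ∈ below ν :=
  fun _ hβ => vec_apply_of_ne (h.trans_le hβ).ne' n

theorem exists_mem_below (g : ValueGroup) : ∃ ν, g ∈ below ν := by
  obtain ⟨b, hb⟩ := (ofColex g).support.finite_toSet.bddAbove
  obtain ⟨ν, hν⟩ := exists_gt b
  refine ⟨ν, fun α hα => ?_⟩
  by_contra h
  exact (hν.trans_le hα).not_ge (hb (Finsupp.mem_support_iff.2 h))

theorem exists_lt_mem_below {δ : Omega1} (hδ : Order.IsSuccLimit δ) {g : ValueGroup}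
    (hg : g ∈ below δ) : ∃ ν < δ, g ∈ below ν := by
  by_cases h : (ofColex g).support.Nonempty
  · set b := (ofColex g).support.max' h
    have hb : b < δ := by
      by_contra hb
      exact Finsupp.mem_support_iff.1 ((ofColex g).support.max'_mem h) (hg _ (not_lt.1 hb))
    obtain ⟨ν, h1, h2⟩ := exists_between_of_isSuccLimit hδ hb
    refine ⟨ν, h2, fun α hα => ?_⟩
    by_contra h0
    exact (h1.trans_le hα).not_ge
      ((ofColex g).support.le_max' α (Finsupp.mem_support_iff.2 h0))
  · obtain ⟨ν, hν⟩ := not_isMin_iff.1 hδ.not_isMin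
    refine ⟨ν, hν, fun α _ => ?_⟩
    by_contra h0
    exact h ⟨α, Finsupp.mem_support_iff.2 h0⟩

/-- A nonnegative element outside of `below ν` exceeds all elements of `below ν`. -/
theorem lt_of_notMem_below {ν : Omega1} {g h : ValueGroup} (hg : 0 ≤ g) (hgν : g ∉ below ν)
    (hh : h ∈ below ν) : h < g := by
  have hg0 : 0 < g := lt_of_le_of_ne hg fun h0 => hgν (h0 ▸ zero_mem _)
  obtain ⟨i, hi, hi'⟩ := lt_iff_coeff.1 hg0
  have hνi : ν ≤ i := by
    by_contra hlt
    exact hgν fun α hα => (hi α ((not_le.1 hlt).trans_le hα)).symm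
  refine lt_iff_coeff.2 ⟨i, fun j hj => ?_, ?_⟩
  · rw [hh j (hνi.trans hj.le), ← hi j hj, coeff_zero]
  · rwa [hh i hνi]

theorem mem_below_of_le {ν : Omega1} {g h : ValueGroup} (hg : 0 ≤ g) (hgh : g ≤ h)
    (hh : h ∈ below ν) : g ∈ below ν := by
  by_contra hc
  exact (lt_of_notMem_below hg hc hh).not_ge hgh

theorem vec_nonneg (α : Omega1) {n : ℤ} (hn : 0 ≤ n) : 0 ≤ vec α n := by
  refine nonneg_of_coeff_nonneg fun β => ?_
  rcases eq_or_ne β α with rfl | h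
  · rwa [vec_apply_self]
  · rw [vec_apply_of_ne h]

theorem vec_notMem_below {α ν : Omega1} (h : ν ≤ α) {n : ℤ} (hn : n ≠ 0) : vec α n ∉ below ν :=
  fun hc => hn ((vec_apply_self α n).symm.trans (hc α h))

theorem vec_one_notMem_below {α ν : Omega1} (h : ν ≤ α) : vec α 1 ∉ below ν :=
  vec_notMem_below h one_ne_zero

theorem lt_vec_one {α ν : Omega1} (h : ν ≤ α) {g : ValueGroup} (hg : g ∈ below ν) :
    g < vec α 1 :=
  lt_of_notMem_below (vec_nonneg α zero_le_one) (vec_one_notMem_below h) hg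

theorem vec_one_mono {μ ν : Omega1} (h : μ ≤ ν) : vec μ 1 ≤ vec ν 1 := by
  rcases h.eq_or_lt with rfl | h
  · exact le_rfl
  · exact (lt_vec_one le_rfl (vec_mem_below h 1)).le

/-- A nonzero element with nonnegative coefficients dominates `vec α 1` for `α` in its support. -/
theorem vec_one_le {g : ValueGroup} (hg : ∀ α, 0 ≤ ofColex g α) {α : Omega1}
    (hα : ofColex g α ≠ 0) : vec α 1 ≤ g := by
  rw [← sub_nonneg]
  refine nonneg_of_coeff_nonneg fun β => ?_
  rw [coeff_sub]
  rcases eq_or_ne β α with rfl | h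
  · rw [vec_apply_self]
    have := hg β
    omega
  · rw [vec_apply_of_ne h, sub_zero]
    exact hg β

/-- The subgroup of elements whose coefficients on `[ν, δ)` vanish. -/
def gap (δ : Omega1) (ν : Set.Iio δ) : AddSubgroup ValueGroup where
  carrier := {g | ∀ α, ν.1 ≤ α → α < δ → ofColex g α = 0}
  add_mem' hg hh α hα hα' := by rw [coeff_add, hg α hα hα', hh α hα hα', add_zero]
  zero_mem' _ _ _ := rfl
  neg_mem' hg α hα hα' := by rw [coeff_neg, hg α hα hα', neg_zero]

theorem mem_gap {δ : Omega1} {ν : Set.Iio δ} {g : ValueGroup} :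
    g ∈ gap δ ν ↔ ∀ α, ν.1 ≤ α → α < δ → ofColex g α = 0 :=
  Iff.rfl

theorem gap_mono (δ : Omega1) : Monotone (gap δ) := fun _ _ h _ hg α hα hα' =>
  hg α (le_trans h hα) hα'

theorem below_le_gap {δ : Omega1} (ν : Set.Iio δ) : below ν ≤ gap δ ν := fun _ hg α hα _ => hg α hα

theorem exists_mem_gap {δ : Omega1} (hδ : Order.IsSuccLimit δ) (g : ValueGroup) :
    ∃ ν, g ∈ gap δ ν := by
  have h : toColex ((ofColex g).filter (· < δ)) ∈ below δ := fun α hα => by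
    simp [hα.not_gt]
  obtain ⟨ν, hν, h'⟩ := exists_lt_mem_below hδ h
  refine ⟨⟨ν, hν⟩, fun α hα hα' => ?_⟩
  have := h' α hα
  simpa [Finsupp.filter_apply, hα'] using this

/-- The endomorphism of the value group deleting all coefficients at ordinals less than `δ`. -/
noncomputable def tail (δ : Omega1) : ValueGroup →+ ValueGroup where
  toFun g := toColex ((ofColex g).filter (δ ≤ ·))
  map_zero' := congrArg toColex (Finsupp.filter_zero _)
  map_add' _ _ := congrArg toColex Finsupp.filter_add

theorem tail_apply_of_le {δ α : Omega1} (h : δ ≤ α) (g : ValueGroup) :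
    ofColex (tail δ g) α = ofColex g α :=
  Finsupp.filter_apply_pos (δ ≤ ·) (ofColex g) h

theorem tail_apply_of_lt {δ α : Omega1} (h : α < δ) (g : ValueGroup) :
    ofColex (tail δ g) α = 0 :=
  Finsupp.filter_apply_neg (δ ≤ ·) (ofColex g) h.not_ge

theorem tail_monotone (δ : Omega1) : Monotone (tail δ) := by
  intro g h hgh
  rcases hgh.eq_or_lt with rfl | hlt
  · exact le_rfl
  obtain ⟨i, hi, hi'⟩ := lt_iff_coeff.1 hlt
  rcases le_or_gt δ i with hδ | hδ
  · refine (lt_iff_coeff.2 ⟨i, fun j hj => ?_, ?_⟩).le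
    · rw [tail_apply_of_le (hδ.trans hj.le), tail_apply_of_le (hδ.trans hj.le), hi j hj]
    · rwa [tail_apply_of_le hδ, tail_apply_of_le hδ]
  · refine le_of_eq (ext_coeff fun α => ?_)
    rcases le_or_gt δ α with hα | hα
    · rw [tail_apply_of_le hα, tail_apply_of_le hα, hi α (hδ.trans_le hα)]
    · rw [tail_apply_of_lt hα, tail_apply_of_lt hα]

theorem tail_eq_tail_iff {δ : Omega1} {g h : ValueGroup} :
    tail δ g = tail δ h ↔ ∀ α, δ ≤ α → ofColex g α = ofColex h α := by
  refine ⟨fun H α hα => ?_, fun H => ext_coeff fun α => ?_⟩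
  · rw [← tail_apply_of_le hα, H, tail_apply_of_le hα]
  · rcases le_or_gt δ α with hα | hα
    · rw [tail_apply_of_le hα, tail_apply_of_le hα, H α hα]
    · rw [tail_apply_of_lt hα, tail_apply_of_lt hα]

theorem tail_eq_zero_iff {δ : Omega1} {g : ValueGroup} : tail δ g = 0 ↔ g ∈ below δ := by
  rw [← map_zero (tail δ), tail_eq_tail_iff]
  rfl

theorem countable_below (ν : Omega1) : (below ν : Set ValueGroup).Countable := by
  have : Countable (Set.Iio ν) := (countable_Iio ν).to_subtype
  have hinj : Function.Injective fun g : below ν =>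
      ((ofColex g.1).comapDomain ((↑) : Set.Iio ν → Omega1) Subtype.val_injective.injOn) := by
    intro g h hgh
    refine Subtype.ext (ext_coeff fun α => ?_)
    rcases lt_or_ge α ν with hα | hα
    · exact DFunLike.congr_fun hgh ⟨α, hα⟩
    · rw [g.2 α hα, h.2 α hα]
  exact hinj.countable

/-- The antilexicographic order on finitely supported functions `ω₁ → ℕ` is a well-order, and this
set is its monotone image. It makes infinite products of binomials legitimate Hahn series. -/
theorem isPWO_coeff_nonneg : {g : ValueGroup | ∀ α, 0 ≤ ofColex g α}.IsPWO := by
  have hmono : Monotone fun g : Colex (Omega1 →₀ ℕ) =>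
      (toColex ((ofColex g).mapRange ((↑) : ℕ → ℤ) rfl) : ValueGroup) := by
    intro g h hgh
    rcases hgh.eq_or_lt with rfl | hlt
    · exact le_rfl
    obtain ⟨i, hi, hi'⟩ := Finsupp.Colex.lt_iff.1 hlt
    refine (lt_iff_coeff.2 ⟨i, fun j hj => ?_, ?_⟩).le
    · exact congrArg ((↑) : ℕ → ℤ) (hi j hj)
    · exact Int.ofNat_lt.2 hi'
  have huniv : (Set.univ : Set (Colex (Omega1 →₀ ℕ))).IsPWO := Set.isPWO_of_wellQuasiOrderedLE _
  refine (huniv.image_of_monotone hmono).mono fun g hg => ?_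
  refine ⟨toColex ((ofColex g).mapRange Int.toNat rfl), trivial, ext_coeff fun α => ?_⟩
  exact Int.toNat_of_nonneg (hg α)

end ValueGroup

/-! ### The valuation domain attached to a subset of `ω₁` -/

section Ring

variable (K : Type u) [Field K] (S : Set Omega1)

instance nonempty_Iio_of_limit (δ : {δ : Omega1 // δ ∈ S ∧ Order.IsSuccLimit δ}) :
    Nonempty (Set.Iio δ.1) :=
  let ⟨μ, hμ⟩ := not_isMin_iff.1 δ.2.2.not_isMin
  ⟨⟨μ, hμ⟩⟩

/-- The field of Hahn series `f` with support in some `below ν`, whose support meets, for all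
limit ordinals `δ ∈ S`, each coset of `below δ` in a subset of a coset of `below ν`, `ν < δ`. -/
noncomputable def seriesField : Subfield (HahnSeries ValueGroup K) :=
  fiberSubfield (π := (0 : ValueGroup →+ ValueGroup)) (N := below) monotone_const
      below_mono.directed_le ⊓
    ⨅ δ : {δ : Omega1 // δ ∈ S ∧ Order.IsSuccLimit δ},
      fiberSubfield (tail_monotone δ.1) (gap_mono δ.1).directed_le

variable {K S}

theorem mem_seriesField {f : HahnSeries ValueGroup K} : f ∈ seriesField K S ↔
    (∃ ν, f.support ⊆ below ν) ∧
      ∀ δ ∈ S, Order.IsSuccLimit δ → FiberwiseIn (tail δ) (gap δ) f := by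
  rw [seriesField, Subfield.mem_inf, Subfield.mem_iInf]
  refine and_congr ⟨fun h => ?_, fun ⟨ν, hν⟩ => ?_⟩ ⟨fun h δ h1 h2 => h ⟨δ, h1, h2⟩,
    fun h δ => h δ.1 δ.2.1 δ.2.2⟩
  -- For the zero homomorphism the fibre over `0` is the whole group, so the fibrewise condition is
  -- a global bound.
  · obtain ⟨ν, hν⟩ := h 0
    exact ⟨ν, fun x hx => hν x hx rfl⟩
  · exact fun _ => ⟨ν, fun x hx _ => hν hx⟩

theorem single_mem_seriesField (g : ValueGroup) (k : K) :
    HahnSeries.single g k ∈ seriesField K S := by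
  refine mem_seriesField.2 ⟨?_, fun δ _ hδ => ?_⟩
  · obtain ⟨ν, hν⟩ := exists_mem_below g
    refine ⟨ν, fun x hx => ?_⟩
    rwa [HahnSeries.eq_of_mem_support_single hx]
  · obtain ⟨ν, hν⟩ := exists_mem_gap hδ g
    have := nonempty_Iio_of_limit (S := Set.univ) ⟨δ, trivial, hδ⟩
    exact fiberwiseIn_single hν k

variable (K) in
/-- The ring of Hahn series with nonnegative support. -/
noncomputable def nonnegSubring : Subring (HahnSeries ValueGroup K) where
  carrier := nonnegSeries K
  mul_mem' {f g} hf hg x hx := by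
    obtain ⟨p, hp, q, hq, rfl⟩ := exists_add_of_mem_support_mul hx
    exact add_nonneg (hf p hp) (hg q hq)
  one_mem' x hx := by
    rw [HahnSeries.support_one] at hx
    exact hx.ge
  add_mem' {f g} hf hg x hx := (mem_or_mem_support_add hx).elim (hf x) (hg x)
  zero_mem' x hx := by simp at hx
  neg_mem' {f} hf x hx := hf x (by rwa [HahnSeries.support_neg] at hx)

theorem mem_nonnegSubring_of_order {f : HahnSeries ValueGroup K} (h : 0 ≤ f.order) :
    f ∈ nonnegSubring K :=
  fun _ hg => h.trans (HahnSeries.order_le_of_coeff_ne_zero hg)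

theorem order_nonneg {f : HahnSeries ValueGroup K} (h : f ∈ nonnegSubring K) : 0 ≤ f.order := by
  rcases eq_or_ne f 0 with rfl | h0
  · simp
  · exact h _ (HahnSeries.coeff_order_eq_zero.not.2 h0)

variable (K S) in
/-- The valuation domain of nonnegative Hahn series in `seriesField K S`. -/
noncomputable def valRing : Subring (HahnSeries ValueGroup K) :=
  nonnegSubring K ⊓ (seriesField K S).toSubring

theorem mem_valRing {f : HahnSeries ValueGroup K} :
    f ∈ valRing K S ↔ f ∈ nonnegSubring K ∧ f ∈ seriesField K S := Iff.rfl

theorem single_mem_valRing {g : ValueGroup} (hg : 0 ≤ g) (k : K) :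
    HahnSeries.single g k ∈ valRing K S :=
  mem_valRing.2 ⟨fun x hx => by rwa [HahnSeries.eq_of_mem_support_single hx],
    single_mem_seriesField g k⟩

/-- The quotient stays in the field `seriesField K S`, and membership in `valRing K S` only asks in
addition that the order be nonnegative. Thus divisibility is comparison of orders. -/
theorem div_mem_valRing {a b : HahnSeries ValueGroup K} (ha : a ∈ valRing K S)
    (hb : b ∈ valRing K S) (ha0 : a ≠ 0) (hab : b = 0 ∨ a.order ≤ b.order) :
    b / a ∈ valRing K S := by
  rcases eq_or_ne b 0 with rfl | hb0
  · rw [zero_div]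
    exact zero_mem _
  refine mem_valRing.2 ⟨mem_nonnegSubring_of_order ?_, div_mem hb.2 ha.2⟩
  have h1 : (b / a).order + a.order = b.order := by
    rw [← HahnSeries.order_mul (div_ne_zero hb0 ha0) ha0, div_mul_cancel₀ b ha0]
  have h2 := hab.resolve_left hb0
  rw [← h1] at h2
  simpa using h2

theorem dvd_of_order_le {a b : valRing K S} (ha : a ≠ 0) (hab : b = 0 ∨ a.1.order ≤ b.1.order) :
    a ∣ b := by
  have ha' : a.1 ≠ 0 := fun h => ha (Subtype.ext h)
  have hab' : b.1 = 0 ∨ a.1.order ≤ b.1.order := hab.imp_left fun h => congrArg Subtype.val h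
  refine ⟨⟨b.1 / a.1, div_mem_valRing a.2 b.2 ha' hab'⟩, Subtype.ext ?_⟩
  exact (mul_div_cancel₀ b.1 ha').symm

instance : ValuationRing (valRing K S) := by
  refine ValuationRing.iff_dvd_total.2 ⟨fun a b => ?_⟩
  rcases eq_or_ne a 0 with rfl | ha
  · exact Or.inr (dvd_zero b)
  rcases eq_or_ne b 0 with rfl | hb
  · exact Or.inl (dvd_zero a)
  exact (le_total a.1.order b.1.order).imp (fun h => dvd_of_order_le ha (Or.inr h))
    (fun h => dvd_of_order_le hb (Or.inr h))

instance : IsLocalRing (valRing K S) := ValuationRing.isLocalRing _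

variable (K S) in
/-- The monomial with exponent `vec ν 1`. -/
noncomputable def monomial (ν : Omega1) : valRing K S :=
  ⟨HahnSeries.single (vec ν 1) 1, single_mem_valRing (vec_nonneg ν zero_le_one) 1⟩

theorem coe_monomial (ν : Omega1) :
    (monomial K S ν : HahnSeries ValueGroup K) = HahnSeries.single (vec ν 1) 1 := rfl

theorem monomial_ne_zero (ν : Omega1) : monomial K S ν ≠ 0 := fun h =>
  HahnSeries.single_ne_zero one_ne_zero (congrArg Subtype.val h)

theorem le_of_monomial_dvd {ν : Omega1} {x : valRing K S} (h : monomial K S ν ∣ x)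
    {g : ValueGroup} (hg : g ∈ x.1.support) : vec ν 1 ≤ g := by
  obtain ⟨y, rfl⟩ := h
  obtain ⟨p, hp, q, hq, rfl⟩ := exists_add_of_mem_support_mul hg
  rw [HahnSeries.eq_of_mem_support_single hp]
  exact le_add_of_nonneg_right (y.2.1 q hq)

theorem monomial_dvd_iff {ν : Omega1} {x : valRing K S} :
    monomial K S ν ∣ x ↔ ∀ g ∈ x.1.support, vec ν 1 ≤ g := by
  refine ⟨fun h g hg => le_of_monomial_dvd h hg, fun h => ?_⟩
  rcases eq_or_ne x 0 with rfl | hx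
  · exact dvd_zero _
  refine dvd_of_order_le (monomial_ne_zero ν) (Or.inr ?_)
  rw [coe_monomial, HahnSeries.order_single one_ne_zero]
  exact h _ (HahnSeries.coeff_order_eq_zero.not.2 fun h => hx (Subtype.ext h))

theorem monomial_dvd_monomial {μ ν : Omega1} (h : μ ≤ ν) : monomial K S μ ∣ monomial K S ν :=
  monomial_dvd_iff.2 fun g hg => by
    rw [HahnSeries.eq_of_mem_support_single hg]
    exact vec_one_mono h

theorem exists_dvd_monomial {x : valRing K S} (hx : x ≠ 0) : ∃ ν, x ∣ monomial K S ν := by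
  obtain ⟨ν, hν⟩ := exists_mem_below x.1.order
  refine ⟨ν, dvd_of_order_le hx (Or.inr ?_)⟩
  rw [coe_monomial, HahnSeries.order_single one_ne_zero]
  exact (lt_vec_one le_rfl hν).le

theorem not_isField_valRing : ¬ IsField (valRing K S) := by
  intro h
  obtain ⟨ν⟩ := (inferInstance : Nonempty Omega1)
  obtain ⟨y, hy⟩ := h.mul_inv_cancel (monomial_ne_zero (K := K) (S := S) ν)
  have h1 : monomial K S ν ∣ 1 := ⟨y, hy.symm⟩
  have h2 := le_of_monomial_dvd h1 (g := 0) (by simp)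
  exact h2.not_gt (lt_vec_one le_rfl (zero_mem (below ν)))

theorem coeff_mul_eq_single {f g : HahnSeries ValueGroup K} {c p q : ValueGroup} (hpq : p + q = c)
    (h : ∀ p' ∈ f.support, ∀ q' ∈ g.support, p' + q' = c → q' = q) :
    (f * g).coeff c = f.coeff p * g.coeff q := by
  rw [HahnSeries.coeff_mul, Finset.sum_eq_single (p, q)]
  · rintro ⟨p', q'⟩ hmem hne
    rw [Finset.mem_antidiagonal] at hmem
    have hq' := h p' hmem.1 q' hmem.2.1 hmem.2.2
    have h3 := hmem.2.2
    simp only at hq' h3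
    subst hq'
    rw [← hpq] at h3
    exact (hne (Prod.ext (add_right_cancel h3) rfl)).elim
  · intro hmem
    rw [Finset.mem_antidiagonal] at hmem
    by_contra h0
    exact hmem ⟨left_ne_zero_of_mul h0, right_ne_zero_of_mul h0, hpq⟩

theorem coeff_zero_mul {f g : HahnSeries ValueGroup K} (hf : f ∈ nonnegSubring K)
    (hg : g ∈ nonnegSubring K) : (f * g).coeff 0 = f.coeff 0 * g.coeff 0 :=
  coeff_mul_eq_single (add_zero 0) fun p hp q hq h =>
    ((add_eq_zero_iff_of_nonneg (hf p hp) (hg q hq)).1 h).2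

variable (K S) in
/-- The constant coefficient, as a ring homomorphism. -/
noncomputable def constCoeff : valRing K S →+* K where
  toFun f := f.1.coeff 0
  map_one' := by simp
  map_mul' f g := coeff_zero_mul f.2.1 g.2.1
  map_zero' := rfl
  map_add' f g := rfl

theorem constCoeff_surjective : Function.Surjective (constCoeff K S) := fun k =>
  ⟨⟨HahnSeries.single 0 k, single_mem_valRing le_rfl k⟩, HahnSeries.coeff_single_same 0 k⟩

theorem isUnit_valRing {f : valRing K S} (h : f.1.coeff 0 ≠ 0) : IsUnit f := by
  have hf : f ≠ 0 := by
    rintro rfl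
    exact h rfl
  refine isUnit_of_dvd_one (dvd_of_order_le hf (Or.inr ?_))
  exact (HahnSeries.order_le_of_coeff_ne_zero h).trans (by simp)

theorem coeff_zero_ne_zero {f : valRing K S} (h : IsUnit f) : f.1.coeff 0 ≠ 0 :=
  (h.map (constCoeff K S)).ne_zero

theorem nonempty_residueField_equiv :
    Nonempty (IsLocalRing.ResidueField (valRing K S) ≃+* K) := by
  have hker : (RingHom.ker (constCoeff K S)).IsMaximal :=
    RingHom.ker_isMaximal_of_surjective _ constCoeff_surjective
  exact ⟨(Ideal.quotEquivOfEq (IsLocalRing.eq_maximalIdeal hker).symm).trans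
    (RingHom.quotientKerEquivOfSurjective constCoeff_surjective)⟩

/-- A series is determined by a bound `ν` of its support and its coefficients on the countable set
`below ν`; CH gives `ℵ₁ ^ ℵ₀ = ℵ₁`. -/
theorem mk_valRing (CH : (𝔠 : Cardinal.{0}) = ℵ₁) (hK : Cardinal.mk K = (ℵ₁ : Cardinal.{u})) :
    Cardinal.mk (valRing K S) = (ℵ₁ : Cardinal.{u}) := by
  have CH' : (𝔠 : Cardinal.{u}) = ℵ₁ := by
    have := congrArg Cardinal.lift.{u} CH
    simpa using this
  apply le_antisymm
  · have henum : ∀ ν : Omega1, ∃ e : ℕ → ValueGroup, (below ν : Set ValueGroup) ⊆ Set.range e :=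
      fun ν => (Set.countable_iff_exists_subset_range).1 (countable_below ν)
    choose e he using henum
    choose b hb using fun f : valRing K S => (mem_seriesField.1 f.2.2).1
    have hinj : Function.Injective fun f : valRing K S =>
        ((ULift.up (b f), fun n => f.1.coeff (e (b f) n)) : ULift.{u} Omega1 × (ℕ → K)) := by
      intro f g hfg
      simp only [Prod.mk.injEq, ULift.up.injEq] at hfg
      obtain ⟨h1, h2⟩ := hfg
      refine Subtype.ext (HahnSeries.ext (funext fun x => ?_))
      by_cases hx : x ∈ below (b f)
      · obtain ⟨n, rfl⟩ := he _ hx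
        have := congrFun h2 n
        rwa [← h1] at this
      · have hf : f.1.coeff x = 0 := by
          by_contra h0
          exact hx (hb f h0)
        have hg : g.1.coeff x = 0 := by
          by_contra h0
          exact hx (h1 ▸ hb g h0)
        rw [hf, hg]
    refine (Cardinal.mk_le_of_injective hinj).trans (le_of_eq ?_)
    have hpow : (ℵ₁ : Cardinal.{u}) ^ (ℵ₀ : Cardinal.{u}) = ℵ₁ := by
      rw [← CH', Cardinal.continuum_power_aleph0]
    rw [Cardinal.mk_prod, Cardinal.mk_uLift, mk_omega1, Cardinal.mk_arrow, hK, Cardinal.mk_nat]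
    simp only [Cardinal.lift_aleph, Cardinal.lift_id, Cardinal.lift_aleph0, Ordinal.lift_one, hpow]
    exact Cardinal.mul_eq_self (Cardinal.aleph0_le_aleph 1)
  · rw [← hK]
    exact Cardinal.mk_le_of_surjective constCoeff_surjective

end Ring

/-! ### Completeness in terms of divisibility -/

section Completeness

variable {R : Type u} [CommRing R] [IsDomain R] {Q : Type w} [Field Q] [Algebra R Q]
  [IsFractionRing R Q]

theorem mem_invSpan {r : R} (hr : r ≠ 0) {x : Q} :
    x ∈ invSpan Q r ↔ ∃ s : R, algebraMap R Q r * x = algebraMap R Q s := by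
  have hr' : algebraMap R Q r ≠ 0 := (IsFractionRing.to_map_eq_zero_iff).not.2 hr
  rw [invSpan, Submodule.mem_span_singleton]
  refine exists_congr fun s => ?_
  rw [Algebra.smul_def, ← div_eq_mul_inv, div_eq_iff hr', eq_comm, mul_comm]

theorem invSpan_mono {r s : R} (hs : s ≠ 0) (h : r ∣ s) :
    invSpan Q r ≤ invSpan Q s := by
  obtain ⟨t, rfl⟩ := h
  intro x hx
  rw [mem_invSpan (left_ne_zero_of_mul hs)] at hx
  obtain ⟨y, hy⟩ := hx
  rw [mem_invSpan hs]
  exact ⟨t * y, by rw [map_mul, map_mul, ← hy]; ring⟩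

theorem dvd_of_inv_mem_invSpan {r s : R} (hr : r ≠ 0) (hs : s ≠ 0)
    (h : (algebraMap R Q r)⁻¹ ∈ invSpan Q s) : r ∣ s := by
  have hr' : algebraMap R Q r ≠ 0 := (IsFractionRing.to_map_eq_zero_iff).not.2 hr
  obtain ⟨t, ht⟩ := (mem_invSpan hs).1 h
  refine ⟨t, IsFractionRing.injective R Q ?_⟩
  rw [map_mul, ← ht]
  field_simp

theorem inv_mem_invSpan (r : R) : (algebraMap R Q r)⁻¹ ∈ invSpan Q r :=
  Submodule.mem_span_singleton_self _

theorem mem_scaledIdeal_one {r : Omega1 → R} {ν : Omega1} {x : R} :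
    x ∈ scaledIdeal (1 : Submodule R Q) r ν ↔ r ν ∣ x := by
  simp only [scaledIdeal, Submodule.mem_comap, Submodule.mem_map, Submodule.mem_one,
    Algebra.linearMap_apply, LinearMap.lsmul_apply]
  constructor
  · rintro ⟨_, ⟨y, rfl⟩, h⟩
    refine ⟨y, IsFractionRing.injective R Q ?_⟩
    rw [map_mul, ← h, Algebra.smul_def]
  · rintro ⟨y, rfl⟩
    exact ⟨_, ⟨y, rfl⟩, by rw [map_mul, Algebra.smul_def]⟩

theorem mem_colonIdeal_one {r : Omega1 → R} (hr : ∀ ν, r ν ≠ 0) {δ : Omega1} {x : R} :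
    x ∈ colonIdeal (1 : Submodule R Q) r δ ↔ ∀ ν < δ, r ν ∣ x := by
  have hr' : ∀ ν, algebraMap R Q (r ν) ≠ 0 := fun ν =>
    (IsFractionRing.to_map_eq_zero_iff).not.2 (hr ν)
  rw [colonIdeal, Submodule.mem_colon]
  constructor
  · intro h ν hν
    have h1 : (algebraMap R Q (r ν))⁻¹ ∈ initialPart Q r δ :=
      Submodule.mem_iSup_of_mem (p := fun ν : Set.Iio δ => invSpan Q (r ν)) ⟨ν, hν⟩
        (inv_mem_invSpan (r ν))
    obtain ⟨y, hy⟩ := Submodule.mem_one.1 (h _ h1)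
    refine ⟨y, IsFractionRing.injective R Q ?_⟩
    rw [map_mul, hy, Algebra.smul_def]
    have := hr' ν
    field_simp
  · intro h
    have hle : initialPart Q r δ ≤ (1 : Submodule R Q).comap (LinearMap.lsmul R Q x) := by
      refine iSup_le fun ν z hz => ?_
      obtain ⟨s, hs⟩ := (mem_invSpan (hr ν)).1 hz
      obtain ⟨t, ht⟩ := h ν ν.2
      rw [Submodule.mem_comap, LinearMap.lsmul_apply, Algebra.smul_def]
      refine Submodule.mem_one.2 ⟨t * s, ?_⟩
      rw [map_mul, ← hs, ht, map_mul]
      ring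
    exact fun z hz => hle hz

theorem mk_mem_basicNhd_one {r : Omega1 → R} (hr : ∀ ν, r ν ≠ 0) {δ ν : Omega1} (hν : ν < δ)
    {x : R} : Ideal.Quotient.mk _ x ∈ basicNhd (1 : Submodule R Q) r δ ν ↔ r ν ∣ x := by
  rw [basicNhd, Ideal.mem_quotient_iff_mem, mem_scaledIdeal_one]
  intro y hy
  exact mem_scaledIdeal_one.2 ((mem_colonIdeal_one hr).1 hy ν hν)

/-- Every sequence in `R` that is Cauchy for the ideals `r_ν R`, `ν < δ`, converges. -/
def DvdComplete (r : Omega1 → R) (δ : Omega1) : Prop :=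
  ∀ x : ℕ → R, (∀ ν < δ, ∃ n₀, ∀ m ≥ n₀, ∀ n ≥ n₀, r ν ∣ x m - x n) →
    ∃ y, ∀ ν < δ, ∃ n₀, ∀ n ≥ n₀, r ν ∣ x n - y

/-- Each ideal `r_ν R` with `ν < δ` contains the ideal divided out, so Cauchy sequences and limits
can be tested on representatives. -/
theorem isCompleteAt_one_iff {r : Omega1 → R} (hr : ∀ ν, r ν ≠ 0) {δ : Omega1} :
    IsCompleteAt (1 : Submodule R Q) r δ ↔ DvdComplete r δ := by
  constructor
  · intro h x hx
    obtain ⟨y, hy⟩ := h (fun n => Ideal.Quotient.mk _ (x n)) fun ν hν => by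
      simpa only [← map_sub, mk_mem_basicNhd_one hr hν] using hx ν hν
    obtain ⟨y, rfl⟩ := Ideal.Quotient.mk_surjective y
    refine ⟨y, fun ν hν => ?_⟩
    simpa only [← map_sub, mk_mem_basicNhd_one hr hν] using hy ν hν
  · intro h x hx
    choose x' hx' using fun n => Ideal.Quotient.mk_surjective (x n)
    obtain rfl : (fun n => Ideal.Quotient.mk _ (x' n)) = x := funext hx'
    obtain ⟨y, hy⟩ := h x' fun ν hν => by
      simpa only [← map_sub, mk_mem_basicNhd_one hr hν] using hx ν hν
    refine ⟨Ideal.Quotient.mk _ y, fun ν hν => ?_⟩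
    simpa only [← map_sub, mk_mem_basicNhd_one hr hν] using hy ν hν

theorem DvdComplete.of_interleaved {r s : Omega1 → R} {δ : Omega1} (h : DvdComplete r δ)
    (hrs : ∀ ν < δ, ∃ μ < δ, r ν ∣ s μ) (hsr : ∀ ν < δ, ∃ μ < δ, s ν ∣ r μ) :
    DvdComplete s δ := by
  intro x hx
  obtain ⟨y, hy⟩ := h x fun ν hν => by
    obtain ⟨μ, hμ, hd⟩ := hrs ν hν
    obtain ⟨n₀, hn⟩ := hx μ hμ
    exact ⟨n₀, fun m hm n hn' => hd.trans (hn m hm n hn')⟩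
  refine ⟨y, fun ν hν => ?_⟩
  obtain ⟨μ, hμ, hd⟩ := hsr ν hν
  obtain ⟨n₀, hn⟩ := hy μ hμ
  exact ⟨n₀, fun n hn' => hd.trans (hn n hn')⟩

end Completeness

/-! ### The invariant `Γ` of the valuation domain -/

section Gamma

variable {K : Type u} [Field K] {S : Set Omega1}

theorem not_dvdComplete_monomial {δ : Omega1} (hδS : δ ∈ S) (hδ : Order.IsSuccLimit δ) :
    ¬ DvdComplete (monomial K S) δ := by
  classical
  intro h
  obtain ⟨c, hcm, hcδ, hc⟩ := exists_cofinal_seq hδ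
  -- The cofinal sequence may repeat values; summing over its image counts each monomial once, so
  -- that all coefficients are `1` in any characteristic.
  set F : ℕ → Finset Omega1 := fun n => (Finset.range n).image c with hF
  have hFm : ∀ {m n}, m ≤ n → F m ⊆ F n := fun hmn =>
    Finset.image_subset_image (Finset.range_mono hmn)
  set x : ℕ → valRing K S := fun n => ∑ α ∈ F n, monomial K S α with hx
  have hsub : ∀ {m n : ℕ}, m ≤ n → x n - x m = ∑ α ∈ F n \ F m, monomial K S α := fun hmn =>
    (Finset.sum_sdiff_eq_sub (hFm hmn)).symm
  have hdvd : ∀ {m n : ℕ}, m ≤ n → monomial K S (c m) ∣ x n - x m := by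
    intro m n hmn
    rw [hsub hmn]
    refine Finset.dvd_sum fun α hα => monomial_dvd_monomial ?_
    rw [Finset.mem_sdiff] at hα
    obtain ⟨k, -, rfl⟩ := Finset.mem_image.1 hα.1
    refine hcm (not_lt.1 fun hk => hα.2 ?_)
    exact Finset.mem_image_of_mem c (Finset.mem_range.2 hk)
  obtain ⟨y, hy⟩ := h x fun ν hν => by
    obtain ⟨k, hk⟩ := hc ν hν
    have hd : ∀ {n}, k ≤ n → monomial K S ν ∣ x n - x k := fun hkn =>
      (monomial_dvd_monomial hk.le).trans (hdvd hkn)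
    refine ⟨k, fun m hm n hn => ?_⟩
    have := dvd_sub (hd hm) (hd hn)
    rwa [sub_sub_sub_cancel_right] at this
  have hcoeff : ∀ n, ∀ β ∈ F n, (x n).1.coeff (vec β 1) = 1 := by
    intro n β hβ
    have h1 : (x n).1 = ∑ α ∈ F n, HahnSeries.single (vec α 1) (1 : K) := by
      simp [hx, coe_monomial]
    rw [h1, HahnSeries.coeff_sum, Finset.sum_eq_single β]
    · exact HahnSeries.coeff_single_same _ _
    · intro α _ hα
      refine HahnSeries.coeff_single_of_ne fun he => hα ?_
      by_contra
      have := vec_apply_of_ne (Ne.symm hα) 1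
      rw [← he, vec_apply_self] at this
      exact one_ne_zero this
    · exact fun h' => (h' hβ).elim
  -- A limit agrees with late partial sums modulo the monomial at the successor of `c k`, which lies
  -- above the exponent `vec (c k) 1`.
  have hmem : ∀ k, vec (c k) 1 ∈ y.1.support := by
    intro k
    obtain ⟨n₀, hn₀⟩ := hy _ (hδ.succ_lt (hcδ k))
    set n := max n₀ (k + 1)
    have hk : c k ∈ F n := Finset.mem_image_of_mem c
      (Finset.mem_range.2 (Nat.lt_of_lt_of_le (Nat.lt_succ_self k) (le_max_right _ _)))
    have h0 : (x n - y).1.coeff (vec (c k) 1) = 0 := by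
      by_contra h0
      have := le_of_monomial_dvd (hn₀ n (le_max_left _ _)) h0
      exact this.not_gt (lt_vec_one (Order.succ_le_of_lt (Order.lt_succ (c k)))
        (vec_mem_below (Order.lt_succ (c k)) 1))
    have h1 : (x n).1.coeff (vec (c k) 1) - y.1.coeff (vec (c k) 1) = 0 := h0
    rw [hcoeff n _ hk] at h1
    rw [HahnSeries.mem_support, ← sub_eq_zero.1 h1]
    exact one_ne_zero
  -- All these exponents lie in the coset `below δ` itself, where the condition at `δ ∈ S` bounds
  -- the support of `y` below `δ`.
  obtain ⟨ν, hν⟩ := (mem_seriesField.1 y.2.2).2 δ hδS hδ 0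
  obtain ⟨k, hk⟩ := hc ν ν.2
  have := mem_gap.1 (hν _ (hmem k) (tail_eq_zero_iff.2 (vec_mem_below (hcδ k) 1))) (c k) hk.le
    (hcδ k)
  rw [vec_apply_self] at this
  exact one_ne_zero this

/-- The limit is formed coefficientwise on `below δ` and is zero elsewhere. Below `vec ν 1` it
agrees with a single term of the sequence, which transfers well-ordering and the support conditions
to it. -/
theorem dvdComplete_monomial {δ : Omega1} (hδS : δ ∉ S) (hδ : Order.IsSuccLimit δ) :
    DvdComplete (monomial K S) δ := by
  classical
  intro x hx
  choose! N hN using hx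
  have hstab : ∀ ν < δ, ∀ n ≥ N ν, ∀ g, g < vec ν 1 → (x n).1.coeff g = (x (N ν)).1.coeff g := by
    intro ν hν n hn g hg
    have h0 : (x n - x (N ν)).1.coeff g = 0 := by
      by_contra h0
      exact (le_of_monomial_dvd (hN ν hν n hn _ le_rfl) h0).not_gt hg
    exact sub_eq_zero.1 h0
  have hex : ∀ g ∈ below δ, ∃ ν < δ, g < vec ν 1 := fun g hg => by
    obtain ⟨ν, hν, hg'⟩ := exists_lt_mem_below hδ hg
    exact ⟨ν, hν, lt_vec_one le_rfl hg'⟩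
  choose! b hbδ hb using hex
  set c : ValueGroup → K := fun g => if g ∈ below δ then (x (N (b g))).1.coeff g else 0 with hc
  have hcout : ∀ g, g ∉ below δ → c g = 0 := fun g hg => by simp [hc, hg]
  have hcν : ∀ ν < δ, ∀ g ∈ below δ, g < vec ν 1 → c g = (x (N ν)).1.coeff g := by
    intro ν hν g hg hgν
    simp only [hc, hg, if_true]
    rw [← hstab ν hν _ (le_max_left (N ν) (N (b g))) g hgν,
      ← hstab _ (hbδ g hg) _ (le_max_right (N ν) (N (b g))) g (hb g hg)]
  have hpwo : (Function.support c).IsPWO := by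
    rw [Set.isPWO_iff_isWF, Set.isWF_iff_no_descending_seq]
    intro f hf hfs
    have h0 : ∀ n, f n ∈ below δ := fun n => by
      by_contra h0
      exact hfs n (hcout _ h0)
    -- A descending sequence stays below its first entry, hence inside the support of one term.
    refine (Set.isWF_iff_no_descending_seq.1 (x (N (b (f 0)))).1.isWF_support f hf) fun n => ?_
    have hn := hfs n
    rwa [Function.mem_support, hcν _ (hbδ _ (h0 0)) _ (h0 n)
      ((hf.antitone (Nat.zero_le n)).trans_lt (hb _ (h0 0)))] at hn
  set y : HahnSeries ValueGroup K := ⟨c, hpwo⟩ with hy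
  have hys : y.support ⊆ below δ := fun g hg => by
    by_contra h0
    exact hg (hcout g h0)
  have hyν : ∀ ν < δ, ∀ g ∈ y.support, g < vec ν 1 → g ∈ (x (N ν)).1.support := by
    intro ν hν g hg hgν
    have := hcν ν hν g (hys hg) hgν
    rw [HahnSeries.mem_support, ← this]
    exact hg
  have hynn : y ∈ nonnegSubring K := fun g hg =>
    (x (N (b g))).2.1 g (hyν _ (hbδ g (hys hg)) g hg (hb g (hys hg)))
  have hymem : y ∈ valRing K S := by
    refine mem_valRing.2 ⟨hynn, mem_seriesField.2 ⟨⟨δ, hys⟩, fun δ' hδ'S hδ' c₀ => ?_⟩⟩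
    have := nonempty_Iio_of_limit (S := Set.univ) ⟨δ', trivial, hδ'⟩
    rcases lt_trichotomy δ δ' with hlt | rfl | hlt
    · exact ⟨⟨δ, hlt⟩, fun g hg _ => below_le_gap ⟨δ, hlt⟩ (hys hg)⟩
    · exact (hδS hδ'S).elim
    · by_cases hne : ∃ g ∈ y.support, tail δ' g = c₀
      · obtain ⟨g, hg, rfl⟩ := hne
        obtain ⟨ν, hν, hgν⟩ := exists_lt_mem_below hδ (hys hg)
        -- Elements of one fibre of `tail δ'` share their coefficients from `δ'` on, so the whole
        -- fibre lies in `below (max ν δ')`, where `y` agrees with one term of the sequence.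
        have hm : max ν δ' < δ := max_lt hν hlt
        obtain ⟨i, hi⟩ := (mem_seriesField.1 (x (N (max ν δ'))).2.2).2 δ' hδ'S hδ' (tail δ' g)
        refine ⟨i, fun h hh hhg => hi h (hyν _ hm h hh (lt_vec_one le_rfl ?_)) hhg⟩
        intro α hα
        rw [tail_eq_tail_iff.1 hhg α ((le_max_right _ _).trans hα)]
        exact hgν α ((le_max_left _ _).trans hα)
      · exact ⟨Classical.arbitrary _, fun g hg hgc => (hne ⟨g, hg, hgc⟩).elim⟩
  refine ⟨⟨y, hymem⟩, fun ν hν => ⟨N ν, fun n hn => monomial_dvd_iff.2 fun g hg => ?_⟩⟩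
  by_contra hlt
  rw [not_le] at hlt
  have hg0 : 0 ≤ g := (x n - ⟨y, hymem⟩).2.1 g hg
  have hgδ : g ∈ below δ :=
    below_mono (hδ.succ_lt hν).le (mem_below_of_le hg0 hlt.le (vec_mem_below (Order.lt_succ ν) 1))
  apply hg
  change (x n).1.coeff g - c g = 0
  rw [hcν ν hν g hgδ hlt, hstab ν hν n hn g hlt, sub_self]

theorem isGeneratingSeq_monomial :
    IsGeneratingSeq (⊤ : Submodule (valRing K S) (FractionRing (valRing K S)))
      (monomial K S) := by
  refine ⟨monomial_ne_zero, fun μ ν h => monomial_dvd_monomial h.le, fun x => ?_⟩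
  refine ⟨fun _ => ?_, fun _ => trivial⟩
  obtain ⟨a, b, hb, rfl⟩ := IsFractionRing.div_surjective (A := valRing K S) x
  have hb0 := nonZeroDivisors.ne_zero hb
  obtain ⟨ν, hν⟩ := exists_dvd_monomial hb0
  refine ⟨ν, invSpan_mono (monomial_ne_zero ν) hν ?_⟩
  rw [mem_invSpan hb0]
  refine ⟨a, mul_div_cancel₀ _ ?_⟩
  exact (IsFractionRing.to_map_eq_zero_iff).not.2 hb0

theorem gammaEq_valRing :
    GammaEq (⊤ : Submodule (valRing K S) (FractionRing (valRing K S))) 1 S := by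
  refine ⟨⟨_, isGeneratingSeq_monomial⟩, fun r hr => ?_⟩
  have h1 : ∀ {s t : Omega1 → valRing K S}
      (_ : IsGeneratingSeq (⊤ : Submodule _ (FractionRing (valRing K S))) s)
      (_ : IsGeneratingSeq (⊤ : Submodule _ (FractionRing (valRing K S))) t),
      ∀ ν, ∃ μ, s ν ∣ t μ := by
    intro s t hs ht ν
    obtain ⟨μ, hμ⟩ := (ht.2.2 (algebraMap _ _ (s ν))⁻¹).1 trivial
    exact ⟨μ, dvd_of_inv_mem_invSpan (hs.1 ν) (ht.1 μ) hμ⟩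
  choose φ hφ using h1 isGeneratingSeq_monomial hr
  choose ψ hψ using h1 hr isGeneratingSeq_monomial
  -- At limits closed under both comparison maps the two sequences are interleaved below `δ` and
  -- define the same topology.
  refine ⟨_, isClub_closurePoints fun ν => max (φ ν) (ψ ν), ?_⟩
  ext δ
  refine and_congr_left fun ⟨hδ, hcl⟩ => ?_
  have hA : ∀ ν < δ, ∃ μ < δ, monomial K S ν ∣ r μ := fun ν hν =>
    ⟨φ ν, (le_max_left _ _).trans_lt (hcl ν hν), hφ ν⟩
  have hB : ∀ ν < δ, ∃ μ < δ, r ν ∣ monomial K S μ := fun ν hν =>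
    ⟨ψ ν, (le_max_right _ _).trans_lt (hcl ν hν), hψ ν⟩
  change Order.IsSuccLimit δ ∧ ¬ IsCompleteAt 1 r δ ↔ δ ∈ S
  rw [isCompleteAt_one_iff hr.1]
  refine ⟨fun h => ?_, fun h => ⟨hδ, fun hcomp => ?_⟩⟩
  · by_contra hS
    exact h.2 ((dvdComplete_monomial hS hδ).of_interleaved hA hB)
  · exact not_dvdComplete_monomial h hδ (hcomp.of_interleaved hB hA)

end Gamma

/-! ### A coherent sequence of finite-to-one functions -/

section Coherent

theorem exists_code (β : Omega1) : ∃ c : Omega1 → ℕ, Set.InjOn c (Set.Iio β) :=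
  Set.countable_iff_exists_injOn.1 (countable_Iio β)

/-- A function to `ℕ` that is injective on the predecessors of `β`. -/
noncomputable def code (β : Omega1) : Omega1 → ℕ := (exists_code β).choose

theorem finite_code_le (β : Omega1) (k : ℕ) : {η | η < β ∧ code β η ≤ k}.Finite :=
  Set.Finite.of_finite_image ((Set.finite_Iic k).subset (by rintro _ ⟨η, hη, rfl⟩; exact hη.2))
    ((exists_code β).choose_spec.mono fun _ h => h.1)

theorem exists_min_code {β ξ : Omega1} (h : ξ < β) :
    ∃ η, (ξ ≤ η ∧ η < β) ∧ ∀ η', ξ ≤ η' → η' < β → code β η ≤ code β η' := by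
  obtain ⟨η, hη, hmin⟩ := WellFounded.has_min (measure (code β)).wf {η | ξ ≤ η ∧ η < β}
    ⟨ξ, le_rfl, h⟩
  exact ⟨η, hη, fun η' h1 h2 => not_lt.1 (hmin η' ⟨h1, h2⟩)⟩

/-- The element of `[ξ, β)` with the least code. -/
noncomputable def step {β ξ : Omega1} (h : ξ < β) : Omega1 := (exists_min_code h).choose

theorem le_step {β ξ : Omega1} (h : ξ < β) : ξ ≤ step h := (exists_min_code h).choose_spec.1.1

theorem step_lt {β ξ : Omega1} (h : ξ < β) : step h < β := (exists_min_code h).choose_spec.1.2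

theorem code_step_le {β ξ η : Omega1} (h : ξ < β) (h1 : ξ ≤ η) (h2 : η < β) :
    code β (step h) ≤ code β η := (exists_min_code h).choose_spec.2 η h1 h2

open scoped Classical in
/-- The coherent sequence of finite-to-one functions `coh β` on the predecessors of `β`. -/
noncomputable def coh (β ξ : Omega1) : ℕ :=
  if h : ξ < β then max (coh (step h) ξ) (code β (step h)) else 0
termination_by β
decreasing_by exact step_lt h

theorem coh_of_lt {β ξ : Omega1} (h : ξ < β) :
    coh β ξ = max (coh (step h) ξ) (code β (step h)) := by
  rw [coh, dif_pos h]

/-- `coh β ξ` is the largest code met on the walk from `β` down to `ξ`. A value at most `k` leaves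
finitely many first steps `η`, and induction applies to each. -/
theorem finite_coh_le (β : Omega1) (k : ℕ) : {ξ | ξ < β ∧ coh β ξ ≤ k}.Finite := by
  induction β using WellFoundedLT.induction with
  | ind β ih =>
    refine ((finite_code_le β k).biUnion
      (t := fun η => insert η {ξ | ξ < η ∧ coh η ξ ≤ k}) fun η hη =>
        (ih η hη.1).insert η).subset ?_
    rintro ξ ⟨hξ, hk⟩
    rw [coh_of_lt hξ, max_le_iff] at hk
    refine Set.mem_biUnion (x := step hξ) ⟨step_lt hξ, hk.2⟩ ?_
    rcases (le_step hξ).eq_or_lt with h | h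
    · exact Or.inl h
    · exact Or.inr ⟨h, hk.1⟩

/-- As `α` is itself a possible step, the first step `η` from `β` towards `ξ < α` has code at most
`code β α`, so there are finitely many `η`. For each of them, `coh β ξ = coh η ξ` up to finitely
many `ξ`, and `coh η` agrees with `coh α` almost everywhere by induction. -/
theorem finite_coh_ne (β : Omega1) : ∀ α < β, {ξ | ξ < α ∧ coh α ξ ≠ coh β ξ}.Finite := by
  induction β using WellFoundedLT.induction with
  | ind β ih =>
    intro α hα
    have hfin : ∀ η < β, {ξ | ξ < α ∧ ξ < η ∧ coh α ξ ≠ coh η ξ}.Finite := by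
      intro η hη
      rcases lt_trichotomy α η with h | rfl | h
      · exact (ih η hη α h).subset fun ξ hξ => ⟨hξ.1, hξ.2.2⟩
      · simp
      · exact (ih α hα η h).subset fun ξ hξ => ⟨hξ.2.1, hξ.2.2.symm⟩
    refine ((finite_code_le β (code β α)).biUnion
      (t := fun η => insert η ({ξ | ξ < α ∧ ξ < η ∧ coh α ξ ≠ coh η ξ} ∪
        {ξ | ξ < η ∧ coh η ξ ≤ code β η})) fun η hη =>
        ((hfin η hη.1).union (finite_coh_le η _)).insert η).subset ?_
    rintro ξ ⟨hξ, hne⟩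
    have hξβ := hξ.trans hα
    refine Set.mem_biUnion (x := step hξβ) ⟨step_lt hξβ, code_step_le hξβ hξ.le hα⟩ ?_
    rcases (le_step hξβ).eq_or_lt with h | h
    · exact Or.inl h
    refine Or.inr ?_
    rw [coh_of_lt hξβ] at hne
    rcases le_total (coh (step hξβ) ξ) (code β (step hξβ)) with hle | hle
    · exact Or.inr ⟨h, hle⟩
    · rw [max_eq_left hle] at hne
      exact Or.inl ⟨hξ, h, hne⟩

end Coherent

/-! ### Infinite products of binomials -/

section Products

variable {K : Type u} [Field K] {S : Set Omega1}

/-- The exponents of the expansion of `∏ α ∈ I, (1 + X ^ ((n α + 1) α))`. -/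
def prodExponents (n : Omega1 → ℕ) (I : Set Omega1) : Set ValueGroup :=
  {g | ∀ α, ofColex g α = 0 ∨ α ∈ I ∧ ofColex g α = n α + 1}

theorem coeff_nonneg_of_mem_prodExponents {n : Omega1 → ℕ} {I : Set Omega1} {g : ValueGroup}
    (hg : g ∈ prodExponents n I) (α : Omega1) : 0 ≤ ofColex g α := by
  rcases hg α with h | h <;> omega

variable (K) in
open scoped Classical in
/-- The Hahn series `∏ α ∈ I, (1 + X ^ ((n α + 1) α))`. -/
noncomputable def prodSeries (n : Omega1 → ℕ) (I : Set Omega1) : HahnSeries ValueGroup K where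
  coeff g := if g ∈ prodExponents n I then 1 else 0
  isPWO_support' := isPWO_coeff_nonneg.mono fun g hg => by
    simp only [Function.mem_support, ne_eq, ite_eq_right_iff, one_ne_zero, imp_false,
      not_not] at hg
    exact coeff_nonneg_of_mem_prodExponents hg

open scoped Classical in
theorem coeff_prodSeries (n : Omega1 → ℕ) (I : Set Omega1) (g : ValueGroup) :
    (prodSeries K n I).coeff g = if g ∈ prodExponents n I then 1 else 0 := rfl

theorem mem_support_prodSeries {n : Omega1 → ℕ} {I : Set Omega1} {g : ValueGroup} :
    g ∈ (prodSeries K n I).support ↔ g ∈ prodExponents n I := by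
  rw [HahnSeries.mem_support, coeff_prodSeries]
  simp

theorem prodSeries_mem_nonneg (n : Omega1 → ℕ) (I : Set Omega1) :
    prodSeries K n I ∈ nonnegSubring K := fun _ hg =>
  nonneg_of_coeff_nonneg (coeff_nonneg_of_mem_prodExponents (mem_support_prodSeries.1 hg))

theorem zero_mem_prodExponents (n : Omega1 → ℕ) (I : Set Omega1) : 0 ∈ prodExponents n I :=
  fun _ => Or.inl rfl

theorem order_prodSeries (n : Omega1 → ℕ) (I : Set Omega1) : (prodSeries K n I).order = 0 :=
  le_antisymm
    (HahnSeries.order_le_of_coeff_ne_zero (mem_support_prodSeries.2 (zero_mem_prodExponents n I)))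
    (order_nonneg (prodSeries_mem_nonneg n I))

theorem prodSeries_ne_zero (n : Omega1 → ℕ) (I : Set Omega1) : prodSeries K n I ≠ 0 :=
  HahnSeries.ne_zero_of_coeff_ne_zero (mem_support_prodSeries.2 (zero_mem_prodExponents n I))

theorem prodSeries_congr {n n' : Omega1 → ℕ} {I : Set Omega1} (h : ∀ α ∈ I, n α = n' α) :
    prodSeries K n I = prodSeries K n' I := by
  have : prodExponents n I = prodExponents n' I := by
    ext g
    refine forall_congr' fun α => or_congr_right (and_congr_right fun hα => ?_)
    rw [h α hα]
  ext g
  rw [coeff_prodSeries, coeff_prodSeries, this]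

/-- The binomial `1 + X ^ ((n α + 1) α)`. -/
noncomputable def binomial (K : Type u) [Field K] (S : Set Omega1) (n : Omega1 → ℕ) (α : Omega1) :
    valRing K S :=
  1 + ⟨HahnSeries.single (vec α (n α + 1)) 1, single_mem_valRing (vec_nonneg α (by omega)) 1⟩

theorem isUnit_binomial (n : Omega1 → ℕ) (α : Omega1) : IsUnit (binomial K S n α) := by
  refine isUnit_valRing ?_
  -- The summand `1` in the exponent matters: `n α` may be zero, and the binomial would then be the
  -- constant `2`.
  have hne : (0 : ValueGroup) ≠ vec α (n α + 1) := fun h => by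
    have h2 := vec_apply_self α (n α + 1)
    rw [← h, coeff_zero] at h2
    omega
  have h1 : (binomial K S n α).1.coeff 0 =
      (1 : HahnSeries ValueGroup K).coeff 0 + (HahnSeries.single (vec α (n α + 1)) 1).coeff 0 := rfl
  rw [h1, HahnSeries.coeff_single_of_ne hne]
  simp

/-- An exponent of the larger product arises in exactly one way, with the monomial of the new factor
used precisely when the coordinate at `α` is nonzero. -/
theorem prodSeries_insert {n : Omega1 → ℕ} {I : Set Omega1} {α : Omega1} (hα : α ∉ I) :
    prodSeries K n (insert α I) = (binomial K S n α).1 * prodSeries K n I := by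
  classical
  have h1 : (binomial K S n α).1 * prodSeries K n I =
      prodSeries K n I + HahnSeries.single (vec α (n α + 1)) 1 * prodSeries K n I := by
    change (1 + HahnSeries.single (vec α (n α + 1)) 1) * prodSeries K n I = _
    rw [add_mul, one_mul]
  have hnot : ∀ g ∈ prodExponents n I, ofColex g α = 0 := fun g hg =>
    (hg α).resolve_right fun h => hα h.1
  rw [h1]
  ext g
  rw [HahnSeries.coeff_add, HahnSeries.coeff_single_mul, one_mul, coeff_prodSeries,
    coeff_prodSeries, coeff_prodSeries]
  by_cases hg0 : ofColex g α = 0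
  · have h2 : g - vec α (n α + 1) ∉ prodExponents n I := fun h => by
      have := hnot _ h
      rw [coeff_sub, vec_apply_self, hg0] at this
      omega
    have h3 : g ∈ prodExponents n (insert α I) ↔ g ∈ prodExponents n I := by
      refine forall_congr' fun β => or_congr_right' fun hβ => and_congr_left fun _ => ?_
      rw [Set.mem_insert_iff, or_iff_right]
      rintro rfl
      exact hβ hg0
    rw [if_neg h2, add_zero]
    exact if_congr h3 rfl rfl
  · have h2 : g ∉ prodExponents n I := fun h => hg0 (hnot g h)
    have h3 : g ∈ prodExponents n (insert α I) ↔ g - vec α (n α + 1) ∈ prodExponents n I := by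
      constructor
      · intro h β
        rw [coeff_sub]
        rcases eq_or_ne β α with rfl | hβ
        · have := (h β).resolve_left hg0
          rw [vec_apply_self]
          omega
        · rw [vec_apply_of_ne hβ, sub_zero]
          refine (h β).imp_right fun h' => ⟨h'.1.resolve_left hβ, h'.2⟩
      · intro h β
        have hβ' := h β
        rw [coeff_sub] at hβ'
        rcases eq_or_ne β α with rfl | hβ
        · have h4 := hnot _ h
          rw [coeff_sub, vec_apply_self] at h4
          exact Or.inr ⟨Set.mem_insert _ _, by omega⟩
        · rw [vec_apply_of_ne hβ, sub_zero] at hβ'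
          exact hβ'.imp_right fun h' => ⟨Or.inr h'.1, h'.2⟩
    rw [if_neg h2, zero_add]
    exact if_congr h3 rfl rfl

theorem prodSeries_union (n : Omega1 → ℕ) (I : Set Omega1) (A : Finset Omega1)
    (h : Disjoint (A : Set Omega1) I) :
    prodSeries K n (A ∪ I) = (∏ α ∈ A, binomial K S n α : valRing K S).1 * prodSeries K n I := by
  classical
  induction A using Finset.induction_on with
  | empty => simp
  | insert α A hα ih =>
    rw [Finset.coe_insert, Set.disjoint_insert_left] at h
    rw [Finset.prod_insert hα, Finset.coe_insert, Set.insert_union,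
      prodSeries_insert (S := S), ih h.2]
    · rw [Subring.coe_mul, mul_assoc]
    · rw [Set.mem_union, not_or]
      exact ⟨hα, h.1⟩

theorem le_of_mem_support_sub {n : Omega1 → ℕ} {μ ν : Omega1} (h : μ ≤ ν) {g : ValueGroup}
    (hg : g ∈ (prodSeries K n (Set.Iio μ) - prodSeries K n (Set.Iio ν)).support) :
    vec μ 1 ≤ g := by
  have hsub : prodExponents n (Set.Iio μ) ⊆ prodExponents n (Set.Iio ν) := fun x hx α =>
    (hx α).imp_right fun h' => ⟨lt_of_lt_of_le h'.1 h, h'.2⟩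
  have h1 : g ∈ prodExponents n (Set.Iio ν) ∧ g ∉ prodExponents n (Set.Iio μ) := by
    rw [HahnSeries.mem_support, HahnSeries.coeff_sub, coeff_prodSeries, coeff_prodSeries] at hg
    by_cases hμ : g ∈ prodExponents n (Set.Iio μ)
    · simp [hμ, hsub hμ] at hg
    · refine ⟨?_, hμ⟩
      by_contra hν
      simp [hμ, hν] at hg
  -- An exponent of the longer product missing from the shorter one involves some `α ≥ μ`.
  obtain ⟨α, hα⟩ := not_forall.1 h1.2
  rw [not_or] at hα
  have hαμ : μ ≤ α := by
    by_contra hlt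
    exact hα.2 ⟨not_le.1 hlt, ((h1.1 α).resolve_left hα.1).2⟩
  exact (vec_one_mono hαμ).trans
    (vec_one_le (coeff_nonneg_of_mem_prodExponents h1.1) hα.1)

variable (K) in
/-- The product of the binomials `1 + X ^ ((coh ν α + 1) α)` for `α < ν`. -/
noncomputable def cohSeries (ν : Omega1) : HahnSeries ValueGroup K :=
  prodSeries K (coh ν) (Set.Iio ν)

/-- The series `cohSeries` cohere up to units of the valuation domain. -/
theorem exists_unit_cohSeries {μ ν : Omega1} (h : μ ≤ ν) :
    ∃ u : valRing K S, IsUnit u ∧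
      ∀ g ∈ (cohSeries K μ - u.1 * cohSeries K ν).support, vec μ 1 ≤ g := by
  have hfin : {ξ | ξ < μ ∧ coh μ ξ ≠ coh ν ξ}.Finite := by
    rcases h.eq_or_lt with rfl | h
    · simp
    · exact finite_coh_ne ν μ h
  set D := hfin.toFinset
  set I := Set.Iio μ \ D
  have hdisj : Disjoint (D : Set Omega1) I := Set.disjoint_sdiff_right
  have hunion : (D : Set Omega1) ∪ I = Set.Iio μ := by
    refine Set.union_sdiff_cancel fun ξ hξ => ?_
    exact ((Set.Finite.mem_toFinset hfin).1 hξ).1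
  have hcongr : prodSeries K (coh μ) I = prodSeries K (coh ν) I := by
    refine prodSeries_congr fun α hα => ?_
    by_contra hne
    exact hα.2 ((Set.Finite.mem_toFinset hfin).2 ⟨hα.1, hne⟩)
  have h1 := prodSeries_union (K := K) (S := S) (coh μ) I D hdisj
  have h2 := prodSeries_union (K := K) (S := S) (coh ν) I D hdisj
  rw [hunion] at h1 h2
  have hq : IsUnit (∏ α ∈ D, binomial K S (coh μ) α) :=
    Submonoid.prod_mem (IsUnit.submonoid (valRing K S)) fun α _ => isUnit_binomial _ α
  have hp : IsUnit (∏ α ∈ D, binomial K S (coh ν) α) :=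
    Submonoid.prod_mem (IsUnit.submonoid (valRing K S)) fun α _ => isUnit_binomial _ α
  set q := ∏ α ∈ D, binomial K S (coh μ) α
  set p := ∏ α ∈ D, binomial K S (coh ν) α
  obtain ⟨p', hp'⟩ := hp.exists_right_inv
  have hp'' : p.1 * p'.1 = 1 := congrArg Subtype.val hp'
  -- The unit exchanges the finitely many factors at which `coh μ` and `coh ν` differ.
  refine ⟨q * p', hq.mul (IsUnit.of_mul_eq_one_right p hp'), fun g hg => ?_⟩
  have h3 : cohSeries K μ - (q * p').1 * cohSeries K ν =
      (q * p').1 * (prodSeries K (coh ν) (Set.Iio μ) - prodSeries K (coh ν) (Set.Iio ν)) := by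
    rw [mul_sub, cohSeries, cohSeries, h1, h2, hcongr, Subring.coe_mul]
    congr 1
    calc q.1 * prodSeries K (coh ν) I
        = q.1 * (p.1 * p'.1) * prodSeries K (coh ν) I := by rw [hp'', mul_one]
      _ = _ := by ring
  rw [h3] at hg
  obtain ⟨x, hx, y, hy, rfl⟩ := exists_add_of_mem_support_mul hg
  exact (le_of_mem_support_sub h hy).trans (le_add_of_nonneg_left ((q * p').2.1 x hx))

end Products

/-! ### Uniserial modules that are unions of chains of cyclic modules -/

section TypeQuotients

variable {R : Type u} [CommRing R] {Q : Type w} [Field Q] [Algebra R Q]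

theorem nonempty_typeQuotient_equiv {J A J' A' : Submodule R Q} (e : Q ≃ₗ[R] Q)
    (hJ : J.map (e : Q →ₗ[R] Q) = J') (hA : A.map (e : Q →ₗ[R] Q) = A') :
    Nonempty (TypeQuotient J A ≃ₗ[R] TypeQuotient J' A') := by
  refine ⟨Submodule.Quotient.equiv _ _ (e.ofSubmodules J J' hJ) ?_⟩
  subst hA
  ext x
  rw [Submodule.mem_map]
  constructor
  · rintro ⟨y, hy, rfl⟩
    exact ⟨y.1, hy, rfl⟩
  · rintro ⟨y, hy, hyx⟩
    obtain ⟨z, hz, hzx⟩ := hJ.ge x.2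
    have hzy : z = y := e.injective (hzx.trans hyx.symm)
    exact ⟨⟨z, hz⟩, hzy ▸ hy, Subtype.ext hzx⟩

end TypeQuotients

/-! ### Chains of cyclic modules: uniseriality, type, and what standardness forces -/

section Chains

variable {R : Type u} [CommRing R] [IsDomain R] [ValuationRing R] {M : Type v} [AddCommGroup M]
  [Module R M]

/-- The elements `a ν` generate a chain of cyclic modules isomorphic to `R / X ν R`, with transition
maps given by the elements `u μ ν`, and the elements `X ν` are cofinal for divisibility. -/
structure IsCyclicChain (X : Omega1 → R) (u : Omega1 → Omega1 → R) (a : Omega1 → M) : Prop where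
  ne_zero : ∀ ν, X ν ≠ 0
  not_isUnit : ∀ ν, ¬ IsUnit (X ν)
  dvd : ∀ μ ν, μ ≤ ν → X μ ∣ X ν
  exists_dvd : ∀ x : R, x ≠ 0 → ∃ ν, x ∣ X ν
  smul_eq_zero_iff : ∀ ν r, r • a ν = 0 ↔ X ν ∣ r
  eq_smul : ∀ μ ν t, μ ≤ ν → X ν = X μ * t → a μ = (u μ ν * t) • a ν

/-- The union of the chain of cyclic modules generated by the elements `a ν`. -/
def chainUnion (R : Type u) [CommRing R] {M : Type v} [AddCommGroup M] [Module R M]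
    (a : Omega1 → M) : Submodule R M :=
  ⨆ ν, Submodule.span R {a ν}

/-- The generators, as elements of `chainUnion R a`. -/
def chainGen (R : Type u) [CommRing R] {M : Type v} [AddCommGroup M] [Module R M]
    (a : Omega1 → M) (ν : Omega1) : chainUnion R a :=
  ⟨a ν, Submodule.mem_iSup_of_mem ν (Submodule.mem_span_singleton_self _)⟩

namespace IsCyclicChain

variable {X : Omega1 → R} {u : Omega1 → Omega1 → R} {a : Omega1 → M}

theorem span_mono (h : IsCyclicChain X u a) : Monotone fun ν => Submodule.span R {a ν} := by
  intro μ ν hμν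
  obtain ⟨t, ht⟩ := h.dvd μ ν hμν
  rw [Submodule.span_singleton_le_iff_mem, h.eq_smul μ ν t hμν ht]
  exact Submodule.smul_mem _ _ (Submodule.mem_span_singleton_self _)

theorem exists_smul_chainGen (h : IsCyclicChain X u a) (x : chainUnion R a) :
    ∃ μ, ∀ ν, μ ≤ ν → ∃ r : R, r • chainGen R a ν = x := by
  obtain ⟨μ, hμ⟩ := (Submodule.mem_iSup_of_directed _ h.span_mono.directed_le).1 x.2
  refine ⟨μ, fun ν hν => ?_⟩
  obtain ⟨r, hr⟩ := Submodule.mem_span_singleton.1 (h.span_mono hν hμ)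
  exact ⟨r, Subtype.ext hr⟩

theorem smul_chainGen_eq_zero_iff (h : IsCyclicChain X u a) {r : R} {ν : Omega1} :
    r • chainGen R a ν = 0 ↔ X ν ∣ r := by
  rw [← h.smul_eq_zero_iff, ← Subtype.coe_inj]
  rfl

theorem chainGen_eq_smul (h : IsCyclicChain X u a) {μ ν : Omega1} {t : R} (hμν : μ ≤ ν)
    (ht : X ν = X μ * t) : chainGen R a μ = (u μ ν * t) • chainGen R a ν :=
  Subtype.ext (h.eq_smul μ ν t hμν ht)

/-- Any two elements are multiples of a common generator, and their coefficients are comparable for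
divisibility. -/
theorem isUniserial (h : IsCyclicChain X u a) : IsUniserial R (chainUnion R a) := by
  intro M N
  by_contra! hMN
  obtain ⟨x, hxM, hxN⟩ := SetLike.not_le_iff_exists.1 hMN.1
  obtain ⟨y, hyN, hyM⟩ := SetLike.not_le_iff_exists.1 hMN.2
  obtain ⟨μ, hμ⟩ := h.exists_smul_chainGen x
  obtain ⟨ν, hν⟩ := h.exists_smul_chainGen y
  obtain ⟨r, rfl⟩ := hμ _ (le_max_left μ ν)
  obtain ⟨s, rfl⟩ := hν _ (le_max_right μ ν)
  rcases ValuationRing.dvd_total r s with ⟨t, rfl⟩ | ⟨t, rfl⟩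
  · rw [mul_comm, mul_smul] at hyM
    exact hyM (M.smul_mem _ hxM)
  · rw [mul_comm, mul_smul] at hxN
    exact hxN (N.smul_mem _ hyN)

theorem exists_smul_eq_chainGen (h : IsCyclicChain X u a) {r : R} (hr : r ≠ 0) (ν : Omega1) :
    ∃ b : chainUnion R a, r • b = chainGen R a ν := by
  obtain ⟨τ, hτ⟩ := h.exists_dvd _ (mul_ne_zero hr (h.ne_zero ν))
  obtain ⟨t, ht⟩ := h.dvd _ _ (le_max_left ν τ)
  obtain ⟨s, hs⟩ := hτ.trans (h.dvd _ _ (le_max_right ν τ))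
  have hts : t = r * s := by
    refine mul_left_cancel₀ (h.ne_zero ν) ?_
    rw [← ht, hs]
    ring
  refine ⟨(u ν (max ν τ) * s) • chainGen R a (max ν τ), ?_⟩
  rw [h.chainGen_eq_smul (le_max_left ν τ) ht, ← mul_smul, hts]
  congr 1
  ring

variable {Q : Type w} [Field Q] [Algebra R Q] [IsFractionRing R Q]

/-- Every nonzero `r` divides a generator, so `D = Q`, while its annihilator is `X ν R`;
multiplication by `X ν` identifies `Q/R` with `Q/X ν R`. -/
theorem isOfType (h : IsCyclicChain X u a) :
    IsOfType (chainUnion R a) (⊤ : Submodule R Q) 1 := by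
  obtain ⟨ν⟩ := (inferInstance : Nonempty Omega1)
  refine ⟨chainGen R a ν, fun h0 => ?_, ?_⟩
  · rw [← one_smul R (chainGen R a ν), h.smul_chainGen_eq_zero_iff] at h0
    exact h.not_isUnit ν (isUnit_of_dvd_one h0)
  have hX0 : algebraMap R Q (X ν) ≠ 0 := (IsFractionRing.to_map_eq_zero_iff).not.2 (h.ne_zero ν)
  let e : Q ≃ₗ[R] Q :=
    LinearEquiv.ofBijective (LinearMap.mulLeft R (algebraMap R Q (X ν)))
      ⟨mul_right_injective₀ hX0, fun y => ⟨_, mul_inv_cancel_left₀ hX0 y⟩⟩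
  refine nonempty_typeQuotient_equiv e ?_ ?_
  · rw [Submodule.map_top, LinearMap.range_eq_top.2 e.surjective, eq_comm, eq_top_iff]
    intro x _
    obtain ⟨p, q, hq, rfl⟩ := IsFractionRing.div_surjective (A := R) x
    have hq0 := nonZeroDivisors.ne_zero hq
    refine Submodule.mem_iSup_of_mem
      (p := fun r : {r : R // ∃ b : chainUnion R a, r • b = chainGen R a ν} =>
        invSpan Q r.1) ⟨q, h.exists_smul_eq_chainGen hq0 ν⟩ ?_
    rw [mem_invSpan hq0]
    exact ⟨p, mul_div_cancel₀ _ ((IsFractionRing.to_map_eq_zero_iff).not.2 hq0)⟩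
  · ext x
    rw [annIn, Submodule.mem_map, Submodule.mem_map]
    constructor
    · rintro ⟨y, hy, rfl⟩
      obtain ⟨y, rfl⟩ := Submodule.mem_one.1 hy
      refine ⟨X ν * y, ?_, map_mul (algebraMap R Q) _ _⟩
      rw [Ideal.mem_torsionOf_iff, h.smul_chainGen_eq_zero_iff]
      exact dvd_mul_right _ _
    · rintro ⟨y, hy, rfl⟩
      rw [Ideal.mem_torsionOf_iff, h.smul_chainGen_eq_zero_iff] at hy
      obtain ⟨y, rfl⟩ := hy
      exact ⟨algebraMap R Q y, Submodule.mem_one.2 ⟨y, rfl⟩, (map_mul (algebraMap R Q) _ _).symm⟩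

end IsCyclicChain

variable {Q : Type w} [Field Q] [Algebra R Q] [IsFractionRing R Q]

/-- Over a valuation ring every `z` is comparable with `q`. If `z` is a multiple of `q`, the
hypothesis decides membership; if `q` is a multiple of `z ∈ A`, then `q ∈ A` and `x` would be a
unit. -/
theorem mem_iff_of_smul_mem_iff {A : Submodule R Q} {q : Q} {x : R}
    (hx : ¬ IsUnit x) (h : ∀ r : R, r • q ∈ A ↔ x ∣ r) (z : Q) :
    z ∈ A ↔ ∃ s : R, z = s • x • q := by
  have hq : q ≠ 0 := by
    rintro rfl
    exact hx (isUnit_of_dvd_one ((h 1).1 (by simp)))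
  refine ⟨fun hz => ?_, ?_⟩
  · rcases ValuationRing.isInteger_or_isInteger R (z / q) with ⟨t, ht⟩ | ⟨t, ht⟩
    · have hz' : z = t • q := by
        rw [Algebra.smul_def, ht, div_mul_cancel₀ z hq]
      rw [hz', h] at hz
      obtain ⟨s, rfl⟩ := hz
      exact ⟨s, by rw [hz', smul_smul, mul_comm]⟩
    · rcases eq_or_ne z 0 with rfl | hz0
      · exact ⟨0, by simp⟩
      refine (hx (isUnit_of_dvd_one ((h 1).1 ?_))).elim
      have hq' : q = t • z := by
        rw [Algebra.smul_def, ht, inv_div, div_mul_cancel₀ q hz0]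
      rw [one_smul, hq']
      exact A.smul_mem t hz
  · rintro ⟨s, rfl⟩
    exact A.smul_mem s ((h x).2 dvd_rfl)

/-- If the union of the chain is standard, then the system of transition maps is trivial. -/
theorem IsCyclicChain.exists_units_of_isStandard {X : Omega1 → R} {u : Omega1 → Omega1 → R}
    {a : Omega1 → M} (hc : IsCyclicChain X u a) (h : IsStandard R Q (chainUnion R a)) :
    ∃ w : Omega1 → R, (∀ ν, IsUnit (w ν)) ∧ ∀ μ ν, μ ≤ ν → X μ ∣ w μ - u μ ν * w ν := by
  obtain ⟨J, A, -, ⟨φ⟩⟩ := h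
  choose q hq using fun ν => Submodule.Quotient.mk_surjective (A.submoduleOf J)
    (φ (chainGen R a ν))
  have hqA : ∀ ν (r : R), r • (q ν).1 ∈ A ↔ X ν ∣ r := by
    intro ν r
    rw [← hc.smul_chainGen_eq_zero_iff, ← φ.map_eq_zero_iff, map_smul, ← hq,
      ← Submodule.Quotient.mk_smul, Submodule.Quotient.mk_eq_zero]
    rfl
  have hA := fun ν => mem_iff_of_smul_mem_iff (hc.not_isUnit ν) (hqA ν)
  obtain ⟨o⟩ := (inferInstance : Nonempty Omega1)
  set c := X o • (q o).1 with hcdef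
  have hc0 : c ≠ 0 := by
    intro h0
    have h1 : (q o).1 = 0 := by
      rw [hcdef, Algebra.smul_def] at h0
      exact (mul_eq_zero.1 h0).resolve_left
        ((IsFractionRing.to_map_eq_zero_iff).not.2 (hc.ne_zero o))
    exact hc.not_isUnit o
      (isUnit_of_dvd_one ((hqA o 1).1 (by rw [h1, smul_zero]; exact zero_mem A)))
  have hsmul : ∀ {b d : R}, b • c = d • c → b = d := by
    intro b d hbd
    rw [Algebra.smul_def, Algebra.smul_def] at hbd
    exact IsFractionRing.injective R Q (mul_right_cancel₀ hc0 hbd)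
  -- Each `X ν • q ν` generates the same cyclic module `A`, so any two of these generators differ by
  -- a unit.
  have hw : ∀ ν, ∃ w : R, IsUnit w ∧ X ν • (q ν).1 = w • c := by
    intro ν
    obtain ⟨s, hs⟩ := (hA o _).1 ((hqA ν _).2 dvd_rfl)
    obtain ⟨s', hs'⟩ := (hA ν _).1 ((hqA o _).2 dvd_rfl)
    refine ⟨s, IsUnit.of_mul_eq_one s' (hsmul ?_), hs⟩
    rw [mul_comm, mul_smul, one_smul, ← hs]
    exact hs'.symm
  choose w hwu hw using hw
  refine ⟨w, hwu, fun μ ν hμν => ?_⟩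
  obtain ⟨t, ht⟩ := hc.dvd μ ν hμν
  have hmem : (q μ).1 - (u μ ν * t) • (q ν).1 ∈ A := by
    have h1 : (Submodule.Quotient.mk (q μ - (u μ ν * t) • q ν) : TypeQuotient J A) = 0 := by
      rw [Submodule.Quotient.mk_sub, Submodule.Quotient.mk_smul, hq, hq,
        hc.chainGen_eq_smul hμν ht, map_smul, sub_self]
    rw [Submodule.Quotient.mk_eq_zero] at h1
    exact h1
  -- Since `A = R c`, multiplying the relation by `X μ` turns it into the congruence of units modulo
  -- `X μ`.
  obtain ⟨s, hs⟩ := (hA o _).1 hmem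
  refine ⟨s, hsmul ?_⟩
  rw [sub_smul, mul_smul, mul_smul, ← hw, ← hw, hcdef, ← hs, smul_sub, ht]
  congr 1
  rw [smul_smul, smul_smul]
  congr 1
  ring

end Chains

/-! ### A non-standard uniserial module -/

section Module

variable (K : Type u) [Field K] (S : Set Omega1)

noncomputable instance : Algebra (valRing K S) (HahnSeries ValueGroup K) :=
  (valRing K S).subtype.toAlgebra

noncomputable instance : Module (valRing K S) (HahnSeries ValueGroup K) := Algebra.toModule

/-- The Hahn series with nonnegative support, as a module over the valuation domain. -/
noncomputable def nonnegSubmodule : Submodule (valRing K S) (HahnSeries ValueGroup K) where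
  carrier := nonnegSubring K
  add_mem' := add_mem
  zero_mem' := zero_mem _
  smul_mem' r _ hx := mul_mem r.2.1 hx

variable {K S} in
theorem mem_nonnegSubmodule {f : HahnSeries ValueGroup K} :
    f ∈ nonnegSubmodule K S ↔ f ∈ nonnegSubring K := Iff.rfl

/-- The class of `cohSeries K ν / X ^ vec ν 1` modulo the series with nonnegative support. -/
noncomputable def gen (ν : Omega1) : HahnSeries ValueGroup K ⧸ nonnegSubmodule K S :=
  (nonnegSubmodule K S).mkQ (cohSeries K ν * HahnSeries.single (-vec ν 1) 1)

variable {K S}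

theorem mul_single_neg_mem_nonneg {f : HahnSeries ValueGroup K} {g : ValueGroup} :
    f * HahnSeries.single (-g) 1 ∈ nonnegSubring K ↔ ∀ x ∈ f.support, g ≤ x := by
  have hc : ∀ x, (f * HahnSeries.single (-g) (1 : K)).coeff (x - g) = f.coeff x := fun x => by
    rw [HahnSeries.coeff_mul_single, mul_one, sub_neg_eq_add, sub_add_cancel]
  constructor
  · intro h x hx
    have hx' : x - g ∈ (f * HahnSeries.single (-g) (1 : K)).support := by
      rw [HahnSeries.mem_support, hc]
      exact hx
    exact sub_nonneg.1 (h _ hx')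
  · intro h x hx
    obtain ⟨p, hp, q, hq, rfl⟩ := exists_add_of_mem_support_mul hx
    rw [HahnSeries.eq_of_mem_support_single hq, ← sub_eq_add_neg]
    exact sub_nonneg.2 (h p hp)

theorem smul_gen (r : valRing K S) (ν : Omega1) : r • gen K S ν =
    (nonnegSubmodule K S).mkQ (r.1 * cohSeries K ν * HahnSeries.single (-vec ν 1) 1) := by
  rw [gen, ← map_smul, mul_assoc]
  rfl

/-- `cohSeries K ν` has order `0`, so it does not affect whether the order of `r` reaches `vec ν 1`.
Since it need not lie in `valRing K S`, the quotient is taken by all nonnegative series. -/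
theorem smul_gen_eq_zero_iff {r : valRing K S} {ν : Omega1} :
    r • gen K S ν = 0 ↔ monomial K S ν ∣ r := by
  rw [smul_gen, Submodule.mkQ_apply, Submodule.Quotient.mk_eq_zero, mem_nonnegSubmodule,
    mul_single_neg_mem_nonneg, monomial_dvd_iff]
  constructor
  · intro h g hg
    have hr : r.1 ≠ 0 := HahnSeries.ne_zero_of_coeff_ne_zero hg
    have hf : cohSeries K ν ≠ 0 := prodSeries_ne_zero _ _
    have h1 := h _ (HahnSeries.coeff_order_eq_zero.not.2 (mul_ne_zero hr hf))
    rw [HahnSeries.order_mul hr hf, cohSeries, order_prodSeries, add_zero] at h1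
    exact h1.trans (HahnSeries.order_le_of_coeff_ne_zero hg)
  · intro h x hx
    obtain ⟨p, hp, q, hq, rfl⟩ := exists_add_of_mem_support_mul hx
    exact (h p hp).trans (le_add_of_nonneg_right (prodSeries_mem_nonneg _ _ q hq))

theorem not_isUnit_monomial (ν : Omega1) : ¬ IsUnit (monomial K S ν) := fun h => by
  have h2 := le_of_monomial_dvd h.dvd (x := (1 : valRing K S)) (g := 0) (by simp)
  exact h2.not_gt (lt_vec_one le_rfl (zero_mem (below ν)))

theorem exists_transition (μ ν : Omega1) : ∃ u : valRing K S, μ ≤ ν →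
    ∀ g ∈ (cohSeries K μ - u.1 * cohSeries K ν).support, vec μ 1 ≤ g := by
  by_cases h : μ ≤ ν
  · obtain ⟨u, -, hu⟩ := exists_unit_cohSeries (K := K) (S := S) h
    exact ⟨u, fun _ => hu⟩
  · exact ⟨0, fun h' => (h h').elim⟩

variable (K S) in
/-- A multiplier carrying `cohSeries K ν` to `cohSeries K μ` modulo `X ^ vec μ 1`. -/
noncomputable def transition (μ ν : Omega1) : valRing K S := (exists_transition μ ν).choose

theorem le_of_mem_support_transition {μ ν : Omega1} (h : μ ≤ ν) {g : ValueGroup}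
    (hg : g ∈ (cohSeries K μ - (transition K S μ ν).1 * cohSeries K ν).support) : vec μ 1 ≤ g :=
  (exists_transition μ ν).choose_spec h g hg

theorem gen_eq_smul {μ ν : Omega1} {t : valRing K S} (h : μ ≤ ν)
    (ht : monomial K S ν = monomial K S μ * t) :
    gen K S μ = (transition K S μ ν * t) • gen K S ν := by
  have ht' : t.1 * HahnSeries.single (-vec ν 1) 1 = HahnSeries.single (-vec μ 1) (1 : K) := by
    have h1 : HahnSeries.single (vec ν 1) (1 : K) = HahnSeries.single (vec μ 1) 1 * t.1 :=
      congrArg Subtype.val ht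
    have h2 : ∀ α, HahnSeries.single (vec α 1) (1 : K) * HahnSeries.single (-vec α 1) 1 = 1 := by
      intro α
      rw [HahnSeries.single_mul_single, add_neg_cancel, one_mul]
      rfl
    calc t.1 * HahnSeries.single (-vec ν 1) 1
        = (HahnSeries.single (vec μ 1) 1 * HahnSeries.single (-vec μ 1) (1 : K)) *
          (t.1 * HahnSeries.single (-vec ν 1) 1) := by rw [h2, one_mul]
      _ = HahnSeries.single (-vec μ 1) (1 : K) * ((HahnSeries.single (vec μ 1) 1 * t.1) *
          HahnSeries.single (-vec ν 1) 1) := by ring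
      _ = _ := by rw [← h1, h2, mul_one]
  rw [smul_gen, gen, ← sub_eq_zero, ← map_sub, Submodule.mkQ_apply,
    Submodule.Quotient.mk_eq_zero, mem_nonnegSubmodule]
  have h3 : cohSeries K μ * HahnSeries.single (-vec μ 1) 1 -
      (transition K S μ ν * t).1 * cohSeries K ν * HahnSeries.single (-vec ν 1) 1 =
      (cohSeries K μ - (transition K S μ ν).1 * cohSeries K ν) * HahnSeries.single (-vec μ 1) 1 := by
    rw [← ht', Subring.coe_mul]
    ring
  rw [h3, mul_single_neg_mem_nonneg]
  exact fun g hg => le_of_mem_support_transition h hg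

theorem isCyclicChain_gen : IsCyclicChain (monomial K S) (transition K S) (gen K S) where
  ne_zero := monomial_ne_zero
  not_isUnit := not_isUnit_monomial
  dvd _ _ := monomial_dvd_monomial
  exists_dvd _ := exists_dvd_monomial
  smul_eq_zero_iff _ _ := smul_gen_eq_zero_iff
  eq_smul _ _ _ := gen_eq_smul

/-- Eliminating the transition element leaves a symmetric congruence between the series and the
units `w`. -/
theorem le_of_mem_support_of_dvd {w : Omega1 → valRing K S} {μ ν : Omega1} (h : μ ≤ ν)
    (hw : monomial K S μ ∣ w μ - transition K S μ ν * w ν) {g : ValueGroup}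
    (hg : g ∈ (cohSeries K μ * (w ν).1 - cohSeries K ν * (w μ).1).support) : vec μ 1 ≤ g := by
  have hsplit : cohSeries K μ * (w ν).1 - cohSeries K ν * (w μ).1 =
      (cohSeries K μ - (transition K S μ ν).1 * cohSeries K ν) * (w ν).1 +
        -((w μ - transition K S μ ν * w ν).1 * cohSeries K ν) := by
    have h1 : (w μ - transition K S μ ν * w ν).1 =
      (w μ).1 - (transition K S μ ν).1 * (w ν).1 := rfl
    rw [h1]
    ring
  rw [hsplit] at hg
  rcases mem_or_mem_support_add hg with hg | hg
  · obtain ⟨x, hx, y, hy, rfl⟩ := exists_add_of_mem_support_mul hg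
    exact (le_of_mem_support_transition h hx).trans (le_add_of_nonneg_right ((w ν).2.1 y hy))
  · rw [HahnSeries.support_neg] at hg
    obtain ⟨x, hx, y, hy, rfl⟩ := exists_add_of_mem_support_mul hg
    exact (le_of_monomial_dvd hw hx).trans
      (le_add_of_nonneg_right (prodSeries_mem_nonneg _ _ y hy))

/-- The exponent `c = (coh δ α + 1)α` occurs in the first product, hence in the second, being
smaller than `vec δ 1`. The units have no relevant exponent involving `α`, so the coordinate at `α`
must come from `cohSeries K δ'`. -/
theorem coh_eq_of_units {w : Omega1 → valRing K S} (hwu : ∀ ν, IsUnit (w ν))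
    {δ δ' : Omega1} (hδ : δ ≤ δ')
    (hw : ∀ g ∈ (cohSeries K δ * (w δ').1 - cohSeries K δ' * (w δ).1).support, vec δ 1 ≤ g)
    {ν : Omega1} (h : ∀ g ∈ (w δ).1.support, g ∈ below δ → g ∈ below ν)
    (h' : ∀ g ∈ (w δ').1.support, g ∈ below δ' → g ∈ below ν)
    {α : Omega1} (hνα : ν ≤ α) (hαδ : α < δ) : coh δ α = coh δ' α := by
  set c := vec α (coh δ α + 1) with hc
  have hcδ : c ∈ below δ := vec_mem_below hαδ _
  have hcα : ofColex c α = coh δ α + 1 := vec_apply_self _ _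
  have hcmem : c ∈ prodExponents (coh δ) (Set.Iio δ) := fun β => by
    rcases eq_or_ne β α with rfl | hβ
    · exact Or.inr ⟨hαδ, hcα⟩
    · exact Or.inl (vec_apply_of_ne hβ _)
  have h1 : (cohSeries K δ * (w δ').1).coeff c ≠ 0 := by
    rw [coeff_mul_eq_single (add_zero c)]
    · refine mul_ne_zero ?_ (coeff_zero_ne_zero (hwu δ'))
      exact mem_support_prodSeries.2 hcmem
    · intro p hp q hq hpq
      have hp0 := prodSeries_mem_nonneg _ _ p hp
      have hq0 := (w δ').2.1 q hq
      have hqν := h' q hq (below_mono hδ (mem_below_of_le hq0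
        (hpq ▸ le_add_of_nonneg_left hp0) hcδ))
      -- As `q` does not involve `α`, the exponent `p` carries the full coordinate of `c` there;
      -- then `p - c` and `q` are both nonnegative with sum zero, so `q = 0`.
      have hpc : 0 ≤ p - c := by
        refine nonneg_of_coeff_nonneg fun β => ?_
        rw [coeff_sub]
        rcases eq_or_ne β α with rfl | hβ
        · rw [← hpq, coeff_add, hqν β hνα, add_zero, sub_self]
        · rw [hc, vec_apply_of_ne hβ, sub_zero]
          exact coeff_nonneg_of_mem_prodExponents (mem_support_prodSeries.1 hp) β
      have hsum : (p - c) + q = 0 := by rw [← hpq]; abel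
      exact ((add_eq_zero_iff_of_nonneg hpc hq0).1 hsum).2
  have h2 : (cohSeries K δ' * (w δ).1).coeff c ≠ 0 := by
    intro h0
    refine (hw c ?_).not_gt (lt_vec_one le_rfl hcδ)
    rw [HahnSeries.mem_support, HahnSeries.coeff_sub, h0, sub_zero]
    exact h1
  obtain ⟨p, hp, q, hq, hpq⟩ := exists_add_of_mem_support_mul h2
  have hqν := h q hq (mem_below_of_le ((w δ).2.1 q hq)
    (hpq ▸ le_add_of_nonneg_left (prodSeries_mem_nonneg _ _ p hp)) hcδ)
  have hpα : ofColex p α = coh δ α + 1 := by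
    rw [← hcα, ← hpq, coeff_add, hqν α hνα, add_zero]
  rcases mem_support_prodSeries.1 hp α with h3 | h3 <;> omega

/-- No tail of `ω₁` carries a function agreeing with `coh δ` for unboundedly many `δ`. -/
theorem not_coherent {T : Set Omega1} (hT : ∀ μ, ∃ δ ∈ T, μ < δ) (ν : Omega1) :
    ¬ ∀ δ ∈ T, ∀ δ' ∈ T, δ ≤ δ' → ∀ α, ν ≤ α → α < δ → coh δ α = coh δ' α := by
  intro h
  choose d hdT hd using hT
  -- The function `α ↦ coh (d α) α` glues the agreeing `coh δ`. Countably many points of an infinite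
  -- fibre would lie below one `d b`, contradicting that `coh (d b)` is finite-to-one.
  have hfin : ∀ k, {α | ν ≤ α ∧ coh (d α) α = k}.Finite := by
    intro k
    by_contra hinf
    have hinf' : {α | ν ≤ α ∧ coh (d α) α = k}.Infinite := hinf
    have hbdd := bddAbove_of_countable (Set.countable_range fun n => (hinf'.natEmbedding _ n).1)
    obtain ⟨b, hb⟩ := hbdd
    refine Set.infinite_range_of_injective (f := fun n => (hinf'.natEmbedding _ n).1)
      (Subtype.val_injective.comp (hinf'.natEmbedding _).injective)
      ((finite_coh_le (d b) k).subset ?_)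
    rintro _ ⟨n, rfl⟩
    set α := hinf'.natEmbedding _ n
    have hαb : α.1 < d b := (hb ⟨n, rfl⟩).trans_lt (hd b)
    refine ⟨hαb, le_of_eq ?_⟩
    refine Eq.trans ?_ α.2.2
    rcases le_total (d b) (d α.1) with hle | hle
    · exact h _ (hdT b) _ (hdT α.1) hle α.1 α.2.1 hαb
    · exact (h _ (hdT α.1) _ (hdT b) hle α.1 α.2.1 (hd _)).symm
  have hcount : (Set.Ici ν).Countable := by
    refine (Set.countable_iUnion fun k => (hfin k).countable).mono fun α hα => ?_
    exact Set.mem_iUnion.2 ⟨_, hα, rfl⟩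
  obtain ⟨b, hb⟩ := bddAbove_of_countable hcount
  obtain ⟨μ, hμ⟩ := exists_gt (max b ν)
  exact (hb ((le_max_right _ _).trans hμ.le)).not_gt ((le_max_left _ _).trans_lt hμ)

theorem not_isStandard_chainUnion_gen (hS : IsStationary S) :
    ¬ IsStandard (valRing K S) (FractionRing (valRing K S)) (chainUnion (valRing K S) (gen K S)) := by
  intro hst
  obtain ⟨w, hwu, hw⟩ := isCyclicChain_gen.exists_units_of_isStandard hst
  have hreg : ∀ δ, ∃ ν, δ ∈ S → Order.IsSuccLimit δ →
      ν < δ ∧ ∀ g ∈ (w δ).1.support, g ∈ below δ → g ∈ below ν := by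
    intro δ
    by_cases hδ : δ ∈ S ∧ Order.IsSuccLimit δ
    -- The defining condition at `δ ∈ S`, applied to the fibre over `0`, bounds the part of `w δ` in
    -- `below δ`.
    · obtain ⟨ν, hν⟩ := (mem_seriesField.1 (w δ).2.2).2 δ hδ.1 hδ.2 0
      refine ⟨ν, fun _ _ => ⟨ν.2, fun g hg hgδ α hα => ?_⟩⟩
      rcases lt_or_ge α δ with h | h
      · exact hν g hg (tail_eq_zero_iff.2 hgδ) α hα h
      · exact hgδ α h
    · exact ⟨δ, fun h1 h2 => (hδ ⟨h1, h2⟩).elim⟩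
  choose f hf using hreg
  -- This is where stationarity of `S` enters: one bound `ν` serves unboundedly many `δ`.
  obtain ⟨ν, hν⟩ := exists_unbounded_of_regressive hS f fun δ h1 h2 => (hf δ h1 h2).1
  refine not_coherent (T := {δ | δ ∈ S ∧ Order.IsSuccLimit δ ∧ f δ ≤ ν}) (fun μ => ?_) ν ?_
  · obtain ⟨δ, h1, h2, h3, h4⟩ := hν μ
    exact ⟨δ, ⟨h1, h2, h4⟩, h3⟩
  · rintro δ ⟨h1, h2, h3⟩ δ' ⟨h1', h2', h3'⟩ hle α hνα hαδ
    exact coh_eq_of_units hwu hle (fun g hg => le_of_mem_support_of_dvd hle (hw δ δ' hle) hg)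
      (fun g hg hgδ => below_mono h3 ((hf δ h1 h2).2 g hg hgδ))
      (fun g hg hgδ => below_mono h3' ((hf δ' h1' h2').2 g hg hgδ)) hνα hαδ

end Module

end Uniserial

theorem theorem11 (CH : (𝔠 : Cardinal.{0}) = ℵ₁) (K : Type u) [Field K]
    (hK : Cardinal.mk K = (ℵ₁ : Cardinal.{u}))
    (S : Set Uniserial.Omega1) (hS : IsStationary S) :
    ∃ (R : Subring (HahnSeries Uniserial.ValueGroup K)) (_ : ValuationRing R),
      (R : Set (HahnSeries Uniserial.ValueGroup K)) ⊆ Uniserial.nonnegSeries K ∧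
      (∀ (k : K) (g : Uniserial.ValueGroup), 0 ≤ g → HahnSeries.single g k ∈ R) ∧
      ¬ IsField R ∧
      Cardinal.mk R = (ℵ₁ : Cardinal.{u}) ∧
      Nonempty (IsLocalRing.ResidueField R ≃+* K) ∧
      Uniserial.GammaEq (⊤ : Submodule R (FractionRing R)) 1 S ∧
      ∃ (U : Type u) (_ : AddCommGroup U) (_ : Module R U),
        Uniserial.IsUniserial R U ∧
        Uniserial.IsOfType U (⊤ : Submodule R (FractionRing R)) 1 ∧
        ¬ Uniserial.IsStandard R (FractionRing R) U :=
  ⟨Uniserial.valRing K S, inferInstance, fun _ hf => hf.1,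
    fun k _ hg => Uniserial.single_mem_valRing hg k, Uniserial.not_isField_valRing,
    Uniserial.mk_valRing CH hK, Uniserial.nonempty_residueField_equiv,
    Uniserial.gammaEq_valRing,
    Uniserial.chainUnion (Uniserial.valRing K S) (Uniserial.gen K S), inferInstance, inferInstance,
    Uniserial.isCyclicChain_gen.isUniserial, Uniserial.isCyclicChain_gen.isOfType,
    Uniserial.not_isStandard_chainUnion_gen hS⟩
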